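/- Let $W$ be a real vector space of finite dimension $n$ with a positive Lebesgue measure $\mathrm{vol}_W$, let $l\ge 2$, and let $n=k_1+\cdots+k_l$ with positive integers $k_i$. A convex body is a non-empty compact convex set. Let $\Delta_l\colon W\to W^l$ be the diagonal embedding and $\operatorname{coker}\Delta_l=W^l/\operatorname{im}\Delta_l$, a space of dimension $n(l-1)$. Equip it with the Lebesgue measure $\nu$ induced by the exact sequence $0\to \operatorname{im}\Delta_l\to W^l\to\operatorname{coker}\Delta_l\to 0$, where $\operatorname{im}\Delta_l\cong W$ carries $\mathrm{vol}_W$ and $W^l$ carries the product measure; that is, $\int_{W^l}\varphi=\int_{\operatorname{coker}\Delta_l}\int_W\varphi(w+\Delta_l(a))\,d\mathrm{vol}_W(a)\,d\nu([w])$ for every continuous compactly supported $\varphi$. For $i=1,\dots,l$ let $f_i\colon W\to\operatorname{coker}\Delta_l$ be the inclusion of $W$ as the $i$-th summand of $W^l$ followed by the canonical projection. For $(n-k_i)$-tuples $\mathcal A_i=(A_{i,1},\dots,A_{i,n-k_i})$, $i=1,\dots,l$, of convex bodies in $W$, put $$\widetilde V(\mathcal A_1,\dots,\mathcal A_l)=V_{\operatorname{coker}\Delta_l}\big(f_1(A_{1,1}),\dots,f_1(A_{1,n-k_1}),\dots,f_l(A_{l,1}),\dots,f_l(A_{l,n-k_l})\big),$$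 where $V_{\operatorname{coker}\Delta_l}$ is the mixed volume in $\operatorname{coker}\Delta_l$, normalized by $V_{\operatorname{coker}\Delta_l}(K,\dots,K)=\nu(K)$. Then the following hold. (a) $\widetilde V(\mathcal A_{\rho(1)},\dots,\mathcal A_{\rho(l)})=\widetilde V(\mathcal A_1,\dots,\mathcal A_l)$ for every permutation $\rho$ of $\{1,\dots,l\}$ (the left-hand side is formed with the partition $n=k_{\rho(1)}+\cdots+k_{\rho(l)}$). (b) $\widetilde V(g\mathcal A_1,\dots,g\mathcal A_l)=\widetilde V(\mathcal A_1,\dots,\mathcal A_l)$ for every $g\in SL(W)$, where $g\mathcal A_i=(gA_{i,1},\dots,gA_{i,n-k_i})$. (c) For every $i\in\{1,\dots,l\}$ and all fixed tuples $\mathcal A_j$, $j\neq i$, the function that sends a convex body $A$ to the value of $\widetilde V$ at these tuples and the $i$-th tuple $(A,\dots,A)$ is an $(n-k_i)$-homogeneous, translation-invariant valuation on the convex bodies in $W$, continuous with respect to the Hausdorff metric. (d) $\widetilde V\ge 0$, and $\widetilde V$ is monotonically increasing in each of the bodies $A_{i,j}$ with respect to inclusion. (e) $\widetilde V(\mathcal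 A_1,\dots,\mathcal A_l)>0$ if and only if there are line segments $S_{i,j}\subset A_{i,j}$, $i=1,\dots,l$, $j=1,\dots,n-k_i$, such that $\dim H_i=n-k_i$ for every $i$ and $\bigcap_{i=1}^l H_i=\{0\}$, where $H_i\subset W$ is the linear subspace spanned by the directions of $S_{i,1},\dots,S_{i,n-k_i}$. -/

import Mathlib

open MeasureTheory Module
open scoped Pointwise

namespace HigherMixed

noncomputable section

/-! ### The Lebesgue measure on the third term of a short exact sequence -/

section QuotientMeasure

variable {W₁ W₂ W₃ : Type*} [AddCommGroup W₁] [AddCommGroup W₂] [AddCommGroup W₃]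
  [TopologicalSpace W₁] [TopologicalSpace W₂] [TopologicalSpace W₃]
  [IsTopologicalAddGroup W₁] [IsTopologicalAddGroup W₂] [IsTopologicalAddGroup W₃]
  [LocallyCompactSpace W₂] [LocallyCompactSpace W₃] [T2Space W₂]
  [MeasurableSpace W₁] [BorelSpace W₁] [MeasurableSpace W₂] [BorelSpace W₂]
  [MeasurableSpace W₃] [BorelSpace W₃]
  {f : W₁ →+ W₂} {g : W₂ →+ W₃}

/-- The Haar measure `ν` on `W₃` that corresponds to `μ₂ ⊗ μ₁*` for a short exact sequence
`0 → W₁ → W₂ → W₃ → 0`: the multiple of an auxiliary Haar measure on `W₃` for which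
`∫_{W₂} φ dμ₂ = ∫_{W₃} (∫_{W₁} φ (b + f a) dμ₁(a)) dν(g b)`,
see `inducedMeasure_quotientMeasure` and `quotientMeasure_unique`. -/
def quotientMeasure (H : TopologicalAddGroup.IsSES f g)
    (μ₁ : Measure W₁) [μ₁.IsAddHaarMeasure] (μ₂ : Measure W₂) [μ₂.IsAddHaarMeasure] :
    Measure W₃ :=
  Measure.addHaarScalarFactor μ₂ (H.inducedMeasure μ₁ (Measure.addHaar : Measure W₃)) •
    (Measure.addHaar : Measure W₃)

instance isAddHaarMeasure_quotientMeasure (H : TopologicalAddGroup.IsSES f g)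
    (μ₁ : Measure W₁) [μ₁.IsAddHaarMeasure] (μ₂ : Measure W₂) [μ₂.IsAddHaarMeasure] :
    (quotientMeasure H μ₁ μ₂).IsAddHaarMeasure := by
  unfold quotientMeasure
  have h := Measure.addHaarScalarFactor_pos_of_isAddHaarMeasure μ₂
    (H.inducedMeasure μ₁ (Measure.addHaar : Measure W₃))
  exact Measure.IsAddHaarMeasure.smul (Measure.addHaar : Measure W₃) (by simpa using h.ne') (by simp)

theorem inducedMeasure_smul (H : TopologicalAddGroup.IsSES f g)
    (μ₁ : Measure W₁) [μ₁.IsAddHaarMeasure] (ν : Measure W₃) [ν.IsAddHaarMeasure]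
    (c : NNReal) [(c • ν).IsAddHaarMeasure] :
    H.inducedMeasure μ₁ (c • ν) = c • H.inducedMeasure μ₁ ν := by
  refine Measure.ext_of_integral_eq_on_compactlySupported fun φ => ?_
  rw [H.integral_inducedMeasure, integral_smul_nnreal_measure, H.integral_inducedMeasure,
    H.integrate_apply, H.integrate_apply, integral_smul_nnreal_measure]

/-- `quotientMeasure H μ₁ μ₂` and `μ₁` induce the measure `μ₂` on the middle term. -/
theorem inducedMeasure_quotientMeasure [SecondCountableTopology W₂]
    (H : TopologicalAddGroup.IsSES f g)
    (μ₁ : Measure W₁) [μ₁.IsAddHaarMeasure] (μ₂ : Measure W₂) [μ₂.IsAddHaarMeasure] :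
    H.inducedMeasure μ₁ (quotientMeasure H μ₁ μ₂) = μ₂ := by
  have : (Measure.addHaarScalarFactor μ₂
      (H.inducedMeasure μ₁ (Measure.addHaar : Measure W₃)) •
        (Measure.addHaar : Measure W₃)).IsAddHaarMeasure :=
    isAddHaarMeasure_quotientMeasure H μ₁ μ₂
  have h := inducedMeasure_smul H μ₁ (Measure.addHaar : Measure W₃)
    (Measure.addHaarScalarFactor μ₂ (H.inducedMeasure μ₁ (Measure.addHaar : Measure W₃)))
  exact h.trans (Measure.isAddLeftInvariant_eq_smul μ₂ _).symm

/-- The preceding property determines `quotientMeasure`. -/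
theorem quotientMeasure_unique [SecondCountableTopology W₂] [SecondCountableTopology W₃]
    (H : TopologicalAddGroup.IsSES f g)
    (μ₁ : Measure W₁) [μ₁.IsAddHaarMeasure] (μ₂ : Measure W₂) [μ₂.IsAddHaarMeasure]
    (ν : Measure W₃) [ν.IsAddHaarMeasure] (h : H.inducedMeasure μ₁ ν = μ₂) :
    ν = quotientMeasure H μ₁ μ₂ := by
  have e : ν = Measure.addHaarScalarFactor ν (quotientMeasure H μ₁ μ₂) •
      quotientMeasure H μ₁ μ₂ := Measure.isAddLeftInvariant_eq_smul _ _
  generalize Measure.addHaarScalarFactor ν (quotientMeasure H μ₁ μ₂) = c at e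
  have e' := inducedMeasure_quotientMeasure H μ₁ μ₂
  subst e
  rw [inducedMeasure_smul, e'] at h
  obtain ⟨K⟩ : Nonempty (TopologicalSpace.PositiveCompacts W₂) := inferInstance
  have h0 : μ₂ K ≠ 0 := (K.interior_nonempty.mono le_rfl |> fun hK =>
    (Measure.measure_pos_of_nonempty_interior μ₂ hK).ne')
  have h1 : μ₂ K ≠ ⊤ := K.isCompact.measure_lt_top.ne
  have h2 : (c : ENNReal) * μ₂ K = 1 * μ₂ K := by
    conv_rhs => rw [← h]
    rw [Measure.smul_apply, ENNReal.smul_def, smul_eq_mul, one_mul]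
  rw [ENNReal.mul_left_inj h0 h1, ENNReal.coe_eq_one] at h2
  rw [h2, one_smul]

end QuotientMeasure

/-! ### Mixed volumes -/

section MixedVolume

variable {U : Type*} [AddCommGroup U] [Module ℝ U] [TopologicalSpace U] [ContinuousAdd U]
  [MeasurableSpace U]

/-- The mixed volume `V_U(K_1, …, K_N)` of `N = dim U` convex bodies, normalized by the Lebesgue
measure `ν`: the polarization
`(1 / N!) * ∑_{I ⊆ {1, …, N}} (-1)^(N - |I|) * ν(∑_{i ∈ I} K_i)`
of the volume, so that `V_U(K, …, K) = ν(K)`. -/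
def mixedVolume (ν : Measure U) {ι : Type*} [Fintype ι] (K : ι → ConvexBody U) : ℝ :=
  ((Fintype.card ι).factorial : ℝ)⁻¹ *
    ∑ I : Finset ι, (-1 : ℝ) ^ (Fintype.card ι - I.card) *
      ν.real ((∑ i ∈ I, K i : ConvexBody U) : Set U)

end MixedVolume

/-! ### Operations on convex bodies and valuations -/

section Bodies

variable {V U : Type*} [NormedAddCommGroup V] [NormedSpace ℝ V] [FiniteDimensional ℝ V]
  [AddCommGroup U] [Module ℝ U] [TopologicalSpace U] [IsTopologicalAddGroup U]
  [ContinuousSMul ℝ U]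

/-- The image of a convex body under a linear map. -/
def mapBody (f : V →ₗ[ℝ] U) (K : ConvexBody V) : ConvexBody U where
  carrier := f '' K
  convex' := K.convex.linear_image f
  isCompact' := K.isCompact.image f.continuous_of_finiteDimensional
  nonempty' := K.nonempty.image f

/-- The translate `x + K` of a convex body. -/
def translate (x : V) (K : ConvexBody V) : ConvexBody V where
  carrier := (fun y => x + y) '' K
  convex' := by simpa [Set.image_add_left] using K.convex.translate x
  isCompact' := K.isCompact.image (continuous_const_add x)
  nonempty' := K.nonempty.image _

/-- `φ(A ∪ B) = φ(A) + φ(B) - φ(A ∩ B)` whenever `A ∪ B` is convex. Here `C` is `A ∪ B` and `D` is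
`A ∩ B`; the latter is a convex body (it is non-empty) as soon as `A ∪ B` is convex. -/
def IsValuation (φ : ConvexBody V → ℝ) : Prop :=
  ∀ A B C D : ConvexBody V, (C : Set V) = (A : Set V) ∪ B → (D : Set V) = (A : Set V) ∩ B →
    φ C = φ A + φ B - φ D

def IsTranslationInvariant (φ : ConvexBody V → ℝ) : Prop :=
  ∀ (x : V) (A : ConvexBody V), φ (translate x A) = φ A

def IsHomogeneous (m : ℕ) (φ : ConvexBody V → ℝ) : Prop :=
  ∀ (t : ℝ) (A : ConvexBody V), 0 ≤ t → φ (t • A) = t ^ m * φ A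

end Bodies

/-! ### The higher rank mixed volume -/

/-- The diagonal embedding `Δ_l : W → W^l`. -/
def diag (W : Type*) [AddCommGroup W] [Module ℝ W] (l : ℕ) : W →ₗ[ℝ] (Fin l → W) :=
  LinearMap.pi fun _ => LinearMap.id

/-- The cokernel of the diagonal embedding, with the quotient topology. -/
abbrev Coker (W : Type*) [AddCommGroup W] [Module ℝ W] (l : ℕ) : Type _ :=
  (Fin l → W) ⧸ LinearMap.range (diag W l)

/-- The map `f_i : W → coker Δ_l`: the inclusion into the `i`-th summand of `W^l` followed by the
canonical projection. -/
def toCoker (W : Type*) [AddCommGroup W] [Module ℝ W] (l : ℕ) (i : Fin l) : W →ₗ[ℝ] Coker W l :=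
  (LinearMap.range (diag W l)).mkQ ∘ₗ LinearMap.single ℝ (fun _ : Fin l => W) i

section Coker

variable {W : Type*} [NormedAddCommGroup W] [NormedSpace ℝ W] [FiniteDimensional ℝ W] {l : ℕ}

instance isClosed_range_diag : IsClosed (LinearMap.range (diag W l) : Set (Fin l → W)) :=
  Submodule.closed_of_finiteDimensional _

instance locallyCompactSpace_coker : LocallyCompactSpace (Coker W l) :=
  have := FiniteDimensional.proper ℝ (Coker W l)
  inferInstance

instance borelSpace_coker [MeasurableSpace W] [BorelSpace W] : BorelSpace (Coker W l) :=
  ⟨by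
    have : SecondCountableTopology (Coker W l) :=
      have := FiniteDimensional.proper ℝ (Coker W l)
      inferInstance
    exact Continuous.map_eq_borel (Y := Coker W l) continuous_quot_mk
      (Submodule.Quotient.mk_surjective (LinearMap.range (diag W l)))⟩

theorem isSES_diag [NeZero l] :
    TopologicalAddGroup.IsSES (diag W l).toAddMonoidHom
      (LinearMap.range (diag W l)).mkQ.toAddMonoidHom where
  isClosedEmbedding := by
    refine LinearMap.isClosedEmbedding_of_injective (f := diag W l) ?_
    exact LinearMap.ker_eq_bot.2 fun x y h => congrFun h 0
  isOpenQuotientMap := QuotientAddGroup.isOpenQuotientMap_mk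
    (N := (LinearMap.range (diag W l)).toAddSubgroup)
  exact := LinearMap.exact_iff.2 (Submodule.ker_mkQ _)

variable [MeasurableSpace W] [BorelSpace W]

/-- The Lebesgue measure on `coker Δ_l` induced by the exact sequence
`0 → im Δ_l → W^l → coker Δ_l → 0`, where `W^l` carries the product measure and `im Δ_l ≅ W` the
measure `μ`. -/
def cokerMeasure (μ : Measure W) [μ.IsAddHaarMeasure] (l : ℕ) [NeZero l] : Measure (Coker W l) :=
  quotientMeasure isSES_diag μ (Measure.pi fun _ : Fin l => μ)

/-- The mixed volume of rank `l - 1` of the `l` tuples `A i = (A_{i,1}, …, A_{i,n-k_i})` of convex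
bodies in `W`, where `n = dim W`: the mixed volume in `coker Δ_l` of all bodies `f_i(A_{i,j})`. -/
def higherMixedVolume (μ : Measure W) [μ.IsAddHaarMeasure] {l : ℕ} [NeZero l] (k : Fin l → ℕ)
    (A : ∀ i : Fin l, Fin (finrank ℝ W - k i) → ConvexBody W) : ℝ :=
  mixedVolume (cokerMeasure μ l)
    fun p : (i : Fin l) × Fin (finrank ℝ W - k i) => mapBody (toCoker W l p.1) (A p.1 p.2)

end Coker

end

end HigherMixed

open HigherMixed

/-! All statements reduce to facts about mixed volumes in `ℝ^N` with `N = n(l-1)`. The sum of the `n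
- k_i` is also `N`, so there are as many bodies as dimensions.

The classical properties of mixed volumes come from an integral formula. For a finite set `S` with
positive weights `w`, put `F(x) = log ∑ w_v exp⟨x, v⟩`. The gradient of `F` is a weighted mean of
the points of `S`, and its Hessian is their covariance. If a Minkowski combination of polytopes has
interior, the corresponding combination of gradients maps `ℝ^N` injectively into it and covers the
interior. Its volume is therefore the integral of the Hessian determinant
(`volume_sum_smul_polytope`). Polarizing, `N!` times the mixed volume is the integral of a mixed
discriminant of covariances, and that is a sum of positive weights times squared determinants
(`mixedDisc_sum_rankOne`).

Non-negativity and homogeneity can be read off the formula. The integral does not depend on the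
weights, so letting the weights of superfluous points tend to zero and applying Fatou's lemma gives
monotonicity. Positivity holds exactly when some determinant of differences of points is non-zero.
Inner approximation by polytopes carries all this over to convex bodies (`mixedVolume_mono`,
`mixedVolume_smul`, `mixedVolume_pos_iff`).

The valuation property, translation invariance and continuity come from the same properties of `B ↦
vol(T B + C)`. Symmetry and `SL(W)`-invariance hold because the induced measure is determined by its
exact sequence, hence is preserved by measure-preserving automorphisms of that sequence. The
condition on the `H_i` is linear independence of the vectors `f_i(d_ij)`: a relation in the cokernel
is a vector `w` common to all the spans (`linearIndependent_toCoker_iff`). -/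

namespace HigherMixed

/-! ### Polarization and mixed discriminants. -/

section MixedDiscriminant

open Finset

/-- Polarization of a multilinear map along the sums `∑ i ∈ I, x a i`. -/
theorem sum_neg_one_pow_multilinear {ι M : Type*} [Fintype ι] [DecidableEq ι] [AddCommGroup M]
    [Module ℝ M] (f : MultilinearMap ℝ (fun _ : ι => M) ℝ) (x : ι → ι → M) :
    ∑ I : Finset ι, (-1 : ℝ) ^ (Fintype.card ι - I.card) * f (fun a => ∑ i ∈ I, x a i) =
      ∑ σ : Equiv.Perm ι, f (fun a => x a (σ a)) := by
  have h1 : ∀ I : Finset ι, f (fun a => ∑ i ∈ I, x a i) =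
      ∑ r : ι → ι, if univ.image r ⊆ I then f (fun a => x a (r a)) else 0 := by
    intro I
    rw [f.map_sum_finset, ← Finset.sum_filter]
    refine Finset.sum_congr ?_ fun _ _ => rfl
    ext r
    simp [Finset.subset_iff]
  -- The alternating sum over all `I` containing the image of `r` cancels unless that image is
  -- everything. Passing to complements turns it into a sum over a full powerset.
  have h2 : ∀ r : ι → ι, ∑ I : Finset ι, (-1 : ℝ) ^ (Fintype.card ι - I.card) *
      (if univ.image r ⊆ I then f (fun a => x a (r a)) else 0) =
      if Function.Bijective r then f (fun a => x a (r a)) else 0 := by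
    intro r
    have h3 : ∑ I : Finset ι, (-1 : ℝ) ^ (Fintype.card ι - I.card) *
        (if univ.image r ⊆ I then f (fun a => x a (r a)) else 0) =
        (∑ J ∈ ((univ.image r)ᶜ).powerset, (-1 : ℝ) ^ J.card) * f (fun a => x a (r a)) := by
      rw [Finset.sum_mul, ← Finset.sum_filter_add_sum_filter_not univ
        (fun I : Finset ι => univ.image r ⊆ I)]
      rw [Finset.sum_eq_zero (s := univ.filter fun I : Finset ι => ¬ univ.image r ⊆ I), add_zero]
      · refine Finset.sum_nbij' (fun I => Iᶜ) (fun J => Jᶜ) ?_ ?_ ?_ ?_ ?_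
        · intro I hI
          simpa using hI
        · intro J hJ
          simp only [mem_powerset] at hJ
          simpa using Finset.subset_compl_comm.1 hJ
        · simp
        · simp
        · intro I hI
          rw [if_pos (by simpa using hI), Finset.card_compl]
      · intro I hI
        rw [if_neg (by simpa using hI), mul_zero]
    rw [h3]
    have h4 : (∑ J ∈ ((univ.image r)ᶜ).powerset, (-1 : ℝ) ^ J.card) =
        if (univ.image r)ᶜ = ∅ then 1 else 0 := by
      have := Finset.sum_powerset_neg_one_pow_card (x := (univ.image r)ᶜ)
      exact_mod_cast this
    rw [h4]
    have h5 : (univ.image r)ᶜ = ∅ ↔ Function.Bijective r := by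
      rw [Finset.compl_eq_empty_iff, ← Finite.surjective_iff_bijective, Finset.eq_univ_iff_forall]
      simp [Function.Surjective]
    simp only [h5, ite_mul, one_mul, zero_mul]
  simp_rw [h1, Finset.mul_sum]
  rw [Finset.sum_comm]
  simp_rw [h2]
  rw [← Finset.sum_filter]
  symm
  refine Finset.sum_bij (fun σ _ => (σ : ι → ι)) ?_ ?_ ?_ ?_
  · intro σ _
    simp
  · intro σ _ τ _ h
    exact DFunLike.coe_injective h
  · intro r hr
    exact ⟨Equiv.ofBijective r (by simpa using hr), mem_univ _, rfl⟩
  · intro σ _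
    rfl

/-- The mixed discriminant of `N` matrices of size `N` (without the factor `1 / N!`). -/
noncomputable def mixedDisc {ι : Type*} [Fintype ι] [DecidableEq ι] (H : ι → Matrix ι ι ℝ) : ℝ :=
  ∑ σ : Equiv.Perm ι, Matrix.det (Matrix.of fun a b => H (σ a) a b)

variable {ι : Type*} [Fintype ι] [DecidableEq ι]

theorem sum_neg_one_pow_det (H : ι → Matrix ι ι ℝ) :
    ∑ I : Finset ι, (-1 : ℝ) ^ (Fintype.card ι - I.card) * (∑ i ∈ I, H i).det = mixedDisc H := by
  have h := sum_neg_one_pow_multilinear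
    (Matrix.detRowAlternating (R := ℝ) (n := ι)).toMultilinearMap (fun a i => H i a)
  refine Eq.trans (Finset.sum_congr rfl fun I _ => ?_) h
  congr 2
  ext a b
  simp [Matrix.sum_apply]

theorem mixedDisc_smul (t : ι → ℝ) (H : ι → Matrix ι ι ℝ) :
    mixedDisc (fun i => t i • H i) = (∏ i, t i) * mixedDisc H := by
  rw [mixedDisc, mixedDisc, Finset.mul_sum]
  refine Finset.sum_congr rfl fun σ _ => ?_
  have := Matrix.det_mul_column (fun a => t (σ a)) (Matrix.of fun a b => H (σ a) a b)
  rw [Equiv.prod_comp σ t] at this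
  exact this

/-- Sorting the rows by `σ⁻¹` and expanding each one produces a first determinant of the chosen `u i
(j i)`, the same for every `σ`. The remaining coefficients, summed over `σ` with signs, are the
Leibniz expansion of a second copy. With non-negative `c` every summand is non-negative. -/
theorem mixedDisc_sum_rankOne {α : Type*} (S : ι → Finset α) (c : ι → α → ℝ) (u : ι → α → ι → ℝ)
    (H : ι → Matrix ι ι ℝ)
    (hH : ∀ i a b, H i a b = ∑ j ∈ S i, c i j * u i j a * u i j b) :
    mixedDisc H = ∑ j ∈ Fintype.piFinset S,
      (∏ i, c i (j i)) * (Matrix.det (Matrix.of fun i => u i (j i))) ^ 2 := by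
  have h1 : ∀ σ : Equiv.Perm ι, Matrix.det (Matrix.of fun a b => H (σ a) a b) =
      ∑ j ∈ Fintype.piFinset S, (∏ i, c i (j i)) *
        ((Equiv.Perm.sign σ : ℤ) * ∏ i, u (σ i) (j (σ i)) i) *
          Matrix.det (Matrix.of fun i => u i (j i)) := by
    intro σ
    have e1 : (Matrix.of fun a b => H (σ a) a b) =
        (Matrix.of fun i b => H i (σ.symm i) b).submatrix σ id := by
      ext a b
      simp
    rw [e1, Matrix.det_permute]
    have e2 : (Matrix.of fun i b => H i (σ.symm i) b) =
        fun i => ∑ j ∈ S i, (c i j * u i j (σ.symm i)) • u i j := by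
      funext i b
      simp [hH, Finset.sum_apply]
    have e3 : Matrix.det (Matrix.of fun i b => H i (σ.symm i) b) =
        ∑ j ∈ Fintype.piFinset S, (∏ i, c i (j i) * u i (j i) (σ.symm i)) *
          Matrix.det (Matrix.of fun i => u i (j i)) := by
      rw [e2]
      have := (Matrix.detRowAlternating (R := ℝ) (n := ι)).toMultilinearMap.map_sum_finset
        (fun i j => (c i j * u i j (σ.symm i)) • u i j) S
      refine this.trans (Finset.sum_congr rfl fun j _ => ?_)
      exact (Matrix.detRowAlternating (R := ℝ) (n := ι)).toMultilinearMap.map_smul_univ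
        (fun i => c i (j i) * u i (j i) (σ.symm i)) (fun i => u i (j i))
    rw [e3, Finset.mul_sum]
    refine Finset.sum_congr rfl fun j _ => ?_
    rw [Finset.prod_mul_distrib, ← Equiv.prod_comp σ fun i => u i (j i) (σ.symm i)]
    simp only [Equiv.symm_apply_apply]
    ring
  rw [mixedDisc]
  simp_rw [h1]
  rw [Finset.sum_comm]
  refine Finset.sum_congr rfl fun j _ => ?_
  rw [sq, ← mul_assoc, ← Finset.sum_mul, ← Finset.mul_sum]
  congr 2
  rw [Matrix.det_apply']
  rfl

theorem continuous_mixedDisc : Continuous (mixedDisc : (ι → Matrix ι ι ℝ) → ℝ) := by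
  unfold mixedDisc
  refine continuous_finsetSum _ fun σ _ => Continuous.matrix_det ?_
  refine continuous_matrix fun a b => ?_
  simp only [Matrix.of_apply]
  fun_prop

end MixedDiscriminant

/-! ### Calculus of log-sum-exp functions of finite point sets. -/

section LogSumExp

open Finset

variable {ι : Type*} [Fintype ι]

/-- The partition function `∑ w_v exp ⟨x, v⟩` of a weighted finite set of points. -/
noncomputable def partFun (S : Finset (ι → ℝ)) (w : (ι → ℝ) → ℝ) (x : ι → ℝ) : ℝ :=
  ∑ v ∈ S, w v * Real.exp (x ⬝ᵥ v)

/-- The Gibbs weights of the points of `S`. -/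
noncomputable def gibbs (S : Finset (ι → ℝ)) (w : (ι → ℝ) → ℝ) (x v : ι → ℝ) : ℝ :=
  w v * Real.exp (x ⬝ᵥ v) / partFun S w x

/-- The gradient of `log (partFun S w)`. -/
noncomputable def gibbsMean (S : Finset (ι → ℝ)) (w : (ι → ℝ) → ℝ) (x : ι → ℝ) : ι → ℝ :=
  ∑ v ∈ S, gibbs S w x v • v

/-- The Hessian of `log (partFun S w)`. -/
noncomputable def gibbsCov (S : Finset (ι → ℝ)) (w : (ι → ℝ) → ℝ) (x : ι → ℝ) :
    Matrix ι ι ℝ :=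
  fun a b => ∑ v ∈ S, gibbs S w x v * (v - gibbsMean S w x) a * (v - gibbsMean S w x) b

variable {S : Finset (ι → ℝ)} {w : (ι → ℝ) → ℝ}

theorem partFun_pos (hS : S.Nonempty) (hw : ∀ v ∈ S, 0 < w v) (x : ι → ℝ) : 0 < partFun S w x :=
  Finset.sum_pos (fun v hv => mul_pos (hw v hv) (Real.exp_pos _)) hS

theorem gibbs_pos (hw : ∀ v ∈ S, 0 < w v) (x : ι → ℝ) {v : ι → ℝ} (hv : v ∈ S) :
    0 < gibbs S w x v :=
  div_pos (mul_pos (hw v hv) (Real.exp_pos _)) (partFun_pos ⟨v, hv⟩ hw x)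

theorem sum_gibbs (hS : S.Nonempty) (hw : ∀ v ∈ S, 0 < w v) (x : ι → ℝ) :
    ∑ v ∈ S, gibbs S w x v = 1 := by
  simp_rw [gibbs]
  rw [← Finset.sum_div]
  exact div_self (partFun_pos hS hw x).ne'

theorem gibbsMean_mem_convexHull (hS : S.Nonempty) (hw : ∀ v ∈ S, 0 < w v) (x : ι → ℝ) :
    gibbsMean S w x ∈ convexHull ℝ (S : Set (ι → ℝ)) :=
  (convex_convexHull ℝ _).sum_mem (fun _ hv => (gibbs_pos hw x hv).le) (sum_gibbs hS hw x)
    fun _ hv => subset_convexHull ℝ _ hv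

theorem continuous_partFun : Continuous (partFun S w) := by
  unfold partFun
  fun_prop

theorem continuous_gibbs (hw : ∀ v ∈ S, 0 < w v) {v : ι → ℝ} (hv : v ∈ S) :
    Continuous fun x => gibbs S w x v := by
  unfold gibbs
  refine Continuous.div (by fun_prop) continuous_partFun fun x => (partFun_pos ⟨v, hv⟩ hw x).ne'

theorem continuous_gibbsMean (hw : ∀ v ∈ S, 0 < w v) : Continuous (gibbsMean S w) :=
  continuous_finsetSum _ fun _ hv => (continuous_gibbs hw hv).smul continuous_const

theorem continuous_gibbsCov (hw : ∀ v ∈ S, 0 < w v) : Continuous (gibbsCov S w) := by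
  refine continuous_matrix fun a b => continuous_finsetSum _ fun v hv => ?_
  have h := continuous_gibbsMean hw
  have h1 : ∀ a, Continuous fun x => (v - gibbsMean S w x) a := fun a =>
    (continuous_apply a).comp (continuous_const.sub h)
  exact ((continuous_gibbs hw hv).mul (h1 a)).mul (h1 b)

/-- The linear form `h ↦ ⟨h, v⟩` as a continuous linear map. -/
noncomputable def dotCLM (v : ι → ℝ) : (ι → ℝ) →L[ℝ] ℝ :=
  ∑ a, v a • ContinuousLinearMap.proj (R := ℝ) (φ := fun _ : ι => ℝ) a

@[simp] theorem dotCLM_apply (v h : ι → ℝ) : dotCLM v h = h ⬝ᵥ v := by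
  simp [dotCLM, dotProduct, mul_comm]

theorem hasFDerivAt_dot (v x : ι → ℝ) :
    HasFDerivAt (fun x : ι → ℝ => x ⬝ᵥ v) (dotCLM v) x := by
  have h := (dotCLM v).hasFDerivAt (x := x)
  rwa [show (⇑(dotCLM v) : (ι → ℝ) → ℝ) = fun x => x ⬝ᵥ v from funext (dotCLM_apply v)] at h

theorem hasFDerivAt_exp_dot (v x : ι → ℝ) :
    HasFDerivAt (fun x : ι → ℝ => Real.exp (x ⬝ᵥ v)) (Real.exp (x ⬝ᵥ v) • dotCLM v) x :=
  (hasFDerivAt_dot v x).exp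

theorem sum_weight_dotCLM (hS : S.Nonempty) (hw : ∀ v ∈ S, 0 < w v) (x : ι → ℝ) :
    ∑ v ∈ S, w v • Real.exp (x ⬝ᵥ v) • dotCLM v = partFun S w x • dotCLM (gibbsMean S w x) := by
  have hZ := (partFun_pos hS hw x).ne'
  ext h
  simp only [_root_.sum_apply, _root_.smul_apply, dotCLM_apply,
    gibbsMean, dotProduct_sum, dotProduct_smul, smul_eq_mul, gibbs, Finset.mul_sum]
  refine Finset.sum_congr rfl fun v _ => ?_
  field_simp

theorem hasFDerivAt_partFun (hS : S.Nonempty) (hw : ∀ v ∈ S, 0 < w v) (x : ι → ℝ) :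
    HasFDerivAt (partFun S w) (partFun S w x • dotCLM (gibbsMean S w x)) x := by
  rw [← sum_weight_dotCLM hS hw]
  unfold partFun
  exact HasFDerivAt.fun_sum fun v _ => (hasFDerivAt_exp_dot v x).const_mul (w v)

theorem hasFDerivAt_log_partFun (hS : S.Nonempty) (hw : ∀ v ∈ S, 0 < w v) (x : ι → ℝ) :
    HasFDerivAt (fun x => Real.log (partFun S w x)) (dotCLM (gibbsMean S w x)) x := by
  have hZ := (partFun_pos hS hw x).ne'
  have := (hasFDerivAt_partFun hS hw x).log hZ
  rwa [smul_smul, inv_mul_cancel₀ hZ, one_smul] at this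

theorem hasFDerivAt_gibbs (hw : ∀ v ∈ S, 0 < w v) (x : ι → ℝ) {v : ι → ℝ} (hv : v ∈ S) :
    HasFDerivAt (fun x => gibbs S w x v) (gibbs S w x v • dotCLM (v - gibbsMean S w x)) x := by
  have hS : S.Nonempty := ⟨v, hv⟩
  have h1 : (fun x => gibbs S w x v) =
      fun x => w v * Real.exp (x ⬝ᵥ v - Real.log (partFun S w x)) := by
    funext x
    rw [Real.exp_sub, Real.exp_log (partFun_pos hS hw x), gibbs, mul_div_assoc]
  have h3 := (((hasFDerivAt_dot v x).sub (hasFDerivAt_log_partFun hS hw x)).exp).const_mul (w v)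
  have h4 : gibbs S w x v = w v * Real.exp (x ⬝ᵥ v - Real.log (partFun S w x)) := congrFun h1 x
  rw [h1]
  convert! h3 using 1
  ext h
  simp [h4, dotProduct_sub, mul_assoc]

theorem sum_gibbs_mul_sub (hS : S.Nonempty) (hw : ∀ v ∈ S, 0 < w v) (x : ι → ℝ) (h : ι → ℝ) :
    ∑ v ∈ S, gibbs S w x v * (h ⬝ᵥ (v - gibbsMean S w x)) = 0 := by
  have h1 : ∑ v ∈ S, gibbs S w x v * (h ⬝ᵥ v) = h ⬝ᵥ gibbsMean S w x := by
    simp [gibbsMean, dotProduct_sum, dotProduct_smul]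
  simp_rw [dotProduct_sub, mul_sub]
  rw [Finset.sum_sub_distrib, h1, ← Finset.sum_mul, sum_gibbs hS hw, one_mul, sub_self]

theorem gibbsCov_mulVec (S : Finset (ι → ℝ)) (w : (ι → ℝ) → ℝ) (x h : ι → ℝ) (a : ι) :
    (gibbsCov S w x).mulVec h a =
      ∑ v ∈ S, gibbs S w x v * (v - gibbsMean S w x) a * (h ⬝ᵥ (v - gibbsMean S w x)) := by
  simp only [gibbsCov, Matrix.mulVec, dotProduct, Finset.sum_mul, Finset.mul_sum]
  rw [Finset.sum_comm]
  exact Finset.sum_congr rfl fun v _ => Finset.sum_congr rfl fun b _ => by ring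

theorem hasFDerivAt_gibbsMean [DecidableEq ι] (hS : S.Nonempty) (hw : ∀ v ∈ S, 0 < w v) (x : ι → ℝ) :
    HasFDerivAt (gibbsMean S w) (LinearMap.toContinuousLinearMap
      (Matrix.toLin' (gibbsCov S w x))) x := by
  have h1 : HasFDerivAt (gibbsMean S w) (∑ v ∈ S,
      (gibbs S w x v • dotCLM (v - gibbsMean S w x)).smulRight v) x := by
    refine HasFDerivAt.fun_sum fun v hv => ?_
    exact (hasFDerivAt_gibbs hw x hv).smul_const v
  convert! h1 using 1
  ext h a
  have h0 := sum_gibbs_mul_sub hS hw x h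
  simp only [LinearMap.coe_toContinuousLinearMap', Matrix.toLin'_apply, gibbsCov_mulVec,
    _root_.sum_apply, ContinuousLinearMap.smulRight_apply, Finset.sum_apply,
    _root_.smul_apply, dotCLM_apply, Pi.smul_apply, smul_eq_mul]
  -- Differentiation yields the factor `v a`, the covariance has `v a` minus its mean. The
  -- difference is a multiple of the centred first moment, which vanishes by `h0`.
  have h3 : ∀ v, gibbs S w x v * (v - gibbsMean S w x) a * (h ⬝ᵥ (v - gibbsMean S w x)) =
      gibbs S w x v * (h ⬝ᵥ (v - gibbsMean S w x)) * v a -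
        gibbsMean S w x a * (gibbs S w x v * (h ⬝ᵥ (v - gibbsMean S w x))) := by
    intro v
    simp only [Pi.sub_apply]
    ring
  simp_rw [h3]
  rw [Finset.sum_sub_distrib, ← Finset.mul_sum, h0, mul_zero, sub_zero]

theorem dot_gibbsCov_mulVec (x y : ι → ℝ) :
    y ⬝ᵥ (gibbsCov S w x).mulVec y =
      ∑ v ∈ S, gibbs S w x v * (y ⬝ᵥ (v - gibbsMean S w x)) ^ 2 := by
  simp only [gibbsCov, dotProduct, Matrix.mulVec, sq, Finset.sum_mul, Finset.mul_sum]
  calc _ = ∑ i, ∑ v ∈ S, ∑ j, y i * (gibbs S w x v * (v - gibbsMean S w x) i *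
        (v - gibbsMean S w x) j * y j) :=
        Finset.sum_congr rfl fun i _ => Finset.sum_comm
    _ = ∑ v ∈ S, ∑ i, ∑ j, y i * (gibbs S w x v * (v - gibbsMean S w x) i *
        (v - gibbsMean S w x) j * y j) := Finset.sum_comm
    _ = _ := by
        refine Finset.sum_congr rfl fun v _ => ?_
        rw [Finset.sum_comm]
        refine Finset.sum_congr rfl fun i _ => Finset.sum_congr rfl fun j _ => by ring

theorem gibbsCov_isSymm (x : ι → ℝ) : (gibbsCov S w x).IsSymm := by
  ext a b
  simp only [gibbsCov, Matrix.transpose_apply]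
  exact Finset.sum_congr rfl fun v _ => by ring

/-- Monotonicity of the gradient of a log-sum-exp function, with the equality case. -/
theorem gibbsMean_sub_dot (hS : S.Nonempty) (hw : ∀ v ∈ S, 0 < w v) (x y : ι → ℝ) :
    0 ≤ (x - y) ⬝ᵥ (gibbsMean S w x - gibbsMean S w y) ∧
      ((x - y) ⬝ᵥ (gibbsMean S w x - gibbsMean S w y) = 0 → ∃ c, ∀ v ∈ S, (x - y) ⬝ᵥ v = c) := by
  have hx := partFun_pos hS hw x
  have hy := partFun_pos hS hw y
  -- With `s = (x - y) ⬝ᵥ v - c`, the weights at `x` are those at `y` times `exp s`. The constant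
  -- `c` drops out because both families of weights sum to one, leaving the average of `(exp s - 1)
  -- * s`, which is positive unless `s = 0`.
  set c := Real.log (partFun S w x) - Real.log (partFun S w y) with hc
  have h1 : (x - y) ⬝ᵥ (gibbsMean S w x - gibbsMean S w y) =
      ∑ v ∈ S, gibbs S w y v * ((Real.exp ((x - y) ⬝ᵥ v - c) - 1) * ((x - y) ⬝ᵥ v - c)) := by
    have e1 : ∀ v, gibbs S w y v * Real.exp ((x - y) ⬝ᵥ v - c) = gibbs S w x v := by
      intro v
      rw [hc, sub_dotProduct, Real.exp_sub, Real.exp_sub, Real.exp_sub, Real.exp_log hx,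
        Real.exp_log hy, gibbs, gibbs]
      have := (Real.exp_pos (y ⬝ᵥ v)).ne'
      field_simp
    have e2 : ∀ v, gibbs S w y v * ((Real.exp ((x - y) ⬝ᵥ v - c) - 1) * ((x - y) ⬝ᵥ v - c)) =
        gibbs S w x v * ((x - y) ⬝ᵥ v) - gibbs S w y v * ((x - y) ⬝ᵥ v) -
          (gibbs S w x v - gibbs S w y v) * c := by
      intro v
      rw [← e1 v]
      ring
    simp_rw [e2]
    rw [Finset.sum_sub_distrib, ← Finset.sum_mul, Finset.sum_sub_distrib, Finset.sum_sub_distrib,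
      sum_gibbs hS hw, sum_gibbs hS hw, sub_self, zero_mul, sub_zero, dotProduct_sub]
    simp [gibbsMean, dotProduct_sum, dotProduct_smul]
  have h2 : ∀ s : ℝ, 0 ≤ (Real.exp s - 1) * s ∧ ((Real.exp s - 1) * s = 0 → s = 0) := by
    intro s
    rcases lt_trichotomy s 0 with hs | rfl | hs
    · have : Real.exp s < 1 := by simpa using hs
      have h : 0 < (Real.exp s - 1) * s := mul_pos_of_neg_of_neg (by linarith) hs
      exact ⟨h.le, fun h' => absurd h' h.ne'⟩
    · simp
    · have : 1 < Real.exp s := Real.one_lt_exp_iff.2 hs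
      have h : 0 < (Real.exp s - 1) * s := mul_pos (by linarith) hs
      exact ⟨h.le, fun h' => absurd h' h.ne'⟩
  have h3 : ∀ v ∈ S, 0 ≤ gibbs S w y v *
      ((Real.exp ((x - y) ⬝ᵥ v - c) - 1) * ((x - y) ⬝ᵥ v - c)) := fun v hv =>
    mul_nonneg (gibbs_pos hw y hv).le (h2 _).1
  rw [h1]
  refine ⟨Finset.sum_nonneg h3, fun h => ⟨c, fun v hv => ?_⟩⟩
  have h4 := (Finset.sum_eq_zero_iff_of_nonneg h3).1 h v hv
  have h5 := (mul_eq_zero.1 h4).resolve_left (gibbs_pos hw y hv).ne'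
  linarith [(h2 _).2 h5]

/-- Each summand is at most the partition function, and a bound by a constant on a linear form
passes to the convex hull. It makes the potential below coercive. -/
theorem exists_dot_le_log_partFun (hw : ∀ v ∈ S, 0 < w v) :
    ∃ C, ∀ x, ∀ q ∈ convexHull ℝ (S : Set (ι → ℝ)), x ⬝ᵥ q ≤ Real.log (partFun S w x) + C := by
  refine ⟨∑ v ∈ S, |Real.log (w v)|, fun x q hq => ?_⟩
  have h1 : Convex ℝ {q : ι → ℝ | x ⬝ᵥ q ≤ Real.log (partFun S w x) + ∑ v ∈ S, |Real.log (w v)|} :=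
    convex_halfSpace_le ⟨fun a b => dotProduct_add x a b, fun c a => dotProduct_smul c x a⟩ _
  refine convexHull_min (fun v hv => ?_) h1 hq
  have h2 : w v * Real.exp (x ⬝ᵥ v) ≤ partFun S w x :=
    Finset.single_le_sum (f := fun v => w v * Real.exp (x ⬝ᵥ v))
      (fun v hv => (mul_pos (hw v hv) (Real.exp_pos _)).le) hv
  have h3 := Real.log_le_log (mul_pos (hw v hv) (Real.exp_pos _)) h2
  rw [Real.log_mul (hw v hv).ne' (Real.exp_pos _).ne', Real.log_exp] at h3
  have h4 : |Real.log (w v)| ≤ ∑ v ∈ S, |Real.log (w v)| :=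
    Finset.single_le_sum (f := fun v => |Real.log (w v)|) (fun v _ => abs_nonneg _) hv
  have h5 := neg_abs_le (Real.log (w v))
  show x ⬝ᵥ v ≤ _
  linarith

end LogSumExp

/-! ### Minkowski sums of convex bodies. -/

section BodySums

variable {U : Type*} [AddCommGroup U] [Module ℝ U] [TopologicalSpace U] [ContinuousAdd U]

theorem coe_sum_body {κ : Type*} (I : Finset κ) (K : κ → ConvexBody U) :
    ((∑ i ∈ I, K i : ConvexBody U) : Set U) = ∑ i ∈ I, (K i : Set U) := by
  classical
  induction I using Finset.induction_on with
  | empty => simp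
  | insert a s ha ih => rw [Finset.sum_insert ha, Finset.sum_insert ha, ConvexBody.coe_add, ih]

theorem mem_sum_body {κ : Type*} {I : Finset κ} {K : κ → ConvexBody U} {x : U} :
    x ∈ ((∑ i ∈ I, K i : ConvexBody U) : Set U) ↔
      ∃ g : κ → U, (∀ i ∈ I, g i ∈ (K i : Set U)) ∧ ∑ i ∈ I, g i = x := by
  rw [coe_sum_body, Set.mem_finsetSum]
  exact ⟨fun ⟨g, hg, h⟩ => ⟨g, fun i hi => hg hi, h⟩,
    fun ⟨g, hg, h⟩ => ⟨g, fun {i} hi => hg i hi, h⟩⟩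

theorem sum_body_mono {κ : Type*} {I : Finset κ} {K K' : κ → ConvexBody U}
    (h : ∀ i ∈ I, (K i : Set U) ⊆ K' i) :
    ((∑ i ∈ I, K i : ConvexBody U) : Set U) ⊆ (∑ i ∈ I, K' i : ConvexBody U) := by
  intro x hx
  obtain ⟨g, hg, rfl⟩ := mem_sum_body.1 hx
  exact mem_sum_body.2 ⟨g, fun i hi => h i hi (hg i hi), rfl⟩

end BodySums

/-! ### Volume of Minkowski combinations of polytopes through the gradient map. -/

section PolytopeVolume

open Finset

variable {ι : Type*}

/-- The convex hull of a finite set of points. -/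
def polytope (S : Finset (ι → ℝ)) (hS : S.Nonempty) : ConvexBody (ι → ℝ) where
  carrier := convexHull ℝ (S : Set (ι → ℝ))
  convex' := convex_convexHull ℝ _
  isCompact' := S.finite_toSet.isCompact_convexHull ℝ
  nonempty' := by simpa using hS

theorem mem_sum_smul_polytope {κ : Type*} {I : Finset κ} {S : κ → Finset (ι → ℝ)}
    {hS : ∀ k, (S k).Nonempty} {t : κ → ℝ} {x : ι → ℝ} :
    x ∈ ((∑ k ∈ I, t k • polytope (S k) (hS k) : ConvexBody (ι → ℝ)) : Set (ι → ℝ)) ↔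
      ∃ g : κ → ι → ℝ, (∀ k ∈ I, g k ∈ convexHull ℝ (S k : Set (ι → ℝ))) ∧
        ∑ k ∈ I, t k • g k = x := by
  rw [mem_sum_body]
  constructor
  · rintro ⟨g, hg, rfl⟩
    have : ∀ k, ∃ q, k ∈ I → q ∈ convexHull ℝ (S k : Set (ι → ℝ)) ∧ t k • q = g k := by
      intro k
      by_cases hk : k ∈ I
      · have h := hg k hk
        rw [ConvexBody.coe_smul, Set.mem_smul_set] at h
        obtain ⟨q, hq, h⟩ := h
        exact ⟨q, fun _ => ⟨hq, h⟩⟩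
      · exact ⟨0, fun h => absurd h hk⟩
    choose q hq using this
    exact ⟨q, fun k hk => (hq k hk).1, Finset.sum_congr rfl fun k hk => (hq k hk).2⟩
  · rintro ⟨g, hg, rfl⟩
    refine ⟨fun k => t k • g k, fun k hk => ?_, rfl⟩
    rw [ConvexBody.coe_smul]
    exact Set.smul_mem_smul_set (hg k hk)

variable [Fintype ι] {κ : Type*} {I : Finset κ} {S : κ → Finset (ι → ℝ)} {w : κ → (ι → ℝ) → ℝ} {t : κ → ℝ}

theorem dot_gibbsMean_of_const {S : Finset (ι → ℝ)} {w : (ι → ℝ) → ℝ} (hS : S.Nonempty)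
    (hw : ∀ v ∈ S, 0 < w v) (x : ι → ℝ) {y : ι → ℝ} {c : ℝ} (h : ∀ v ∈ S, y ⬝ᵥ v = c) :
    y ⬝ᵥ gibbsMean S w x = c := by
  rw [gibbsMean, dotProduct_sum]
  calc _ = ∑ v ∈ S, gibbs S w x v * c := Finset.sum_congr rfl fun v hv => by
        rw [dotProduct_smul, h v hv, smul_eq_mul]
    _ = c := by rw [← Finset.sum_mul, sum_gibbs hS hw, one_mul]

theorem dot_sum_smul_gibbsCov_mulVec (x y : ι → ℝ) :
    y ⬝ᵥ (∑ k ∈ I, t k • gibbsCov (S k) (w k) x).mulVec y =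
      ∑ k ∈ I, t k * ∑ v ∈ S k, gibbs (S k) (w k) x v *
        (y ⬝ᵥ (v - gibbsMean (S k) (w k) x)) ^ 2 := by
  rw [Matrix.sum_mulVec, dotProduct_sum]
  refine Finset.sum_congr rfl fun k _ => ?_
  rw [Matrix.smul_mulVec, dotProduct_smul, dot_gibbsCov_mulVec, smul_eq_mul]

/-- The quadratic form at `y` is a combination of variances of `v ↦ y ⬝ᵥ v`, so it vanishes only if
this form is constant on every `S k` that contributes. The hypothesis `hI` says that the Minkowski
combination lies in no hyperplane. -/
theorem sum_smul_gibbsCov_posDef (hw : ∀ k, ∀ v ∈ S k, 0 < w k v) (ht : ∀ k, 0 ≤ t k)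
    (hI : ∀ y : ι → ℝ, (∀ k ∈ I, t k ≠ 0 → ∃ c, ∀ v ∈ S k, y ⬝ᵥ v = c) → y = 0) (x : ι → ℝ) :
    (∑ k ∈ I, t k • gibbsCov (S k) (w k) x).PosDef := by
  refine Matrix.PosDef.of_dotProduct_mulVec_pos ?_ fun y hy => ?_
  · rw [Matrix.IsHermitian, Matrix.conjTranspose_eq_transpose_of_trivial, Matrix.transpose_sum]
    exact Finset.sum_congr rfl fun k _ => by
      rw [Matrix.transpose_smul, (gibbsCov_isSymm x).eq]
  · rw [star_trivial, dot_sum_smul_gibbsCov_mulVec]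
    have h1 : ∀ k ∈ I, ∀ v ∈ S k, 0 ≤ gibbs (S k) (w k) x v *
        (y ⬝ᵥ (v - gibbsMean (S k) (w k) x)) ^ 2 := fun k _ v hv =>
      mul_nonneg (gibbs_pos (hw k) x hv).le (sq_nonneg _)
    have h2 : ∀ k ∈ I, 0 ≤ t k * ∑ v ∈ S k, gibbs (S k) (w k) x v *
        (y ⬝ᵥ (v - gibbsMean (S k) (w k) x)) ^ 2 := fun k hk =>
      mul_nonneg (ht k) (Finset.sum_nonneg (h1 k hk))
    refine lt_of_le_of_ne (Finset.sum_nonneg h2) fun h => hy (hI y fun k hk hk0 => ?_)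
    have h3 := (Finset.sum_eq_zero_iff_of_nonneg h2).1 h.symm k hk
    have h4 := (mul_eq_zero.1 h3).resolve_left hk0
    refine ⟨y ⬝ᵥ gibbsMean (S k) (w k) x, fun v hv => ?_⟩
    have h5 := (Finset.sum_eq_zero_iff_of_nonneg (h1 k hk)).1 h4 v hv
    have h6 := (mul_eq_zero.1 h5).resolve_left (gibbs_pos (hw k) x hv).ne'
    rw [dotProduct_sub] at h6
    linarith [pow_eq_zero_iff (two_ne_zero) |>.1 h6]

theorem injective_sum_smul_gibbsMean (hS : ∀ k, (S k).Nonempty)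
    (hw : ∀ k, ∀ v ∈ S k, 0 < w k v) (ht : ∀ k, 0 ≤ t k)
    (hI : ∀ y : ι → ℝ, (∀ k ∈ I, t k ≠ 0 → ∃ c, ∀ v ∈ S k, y ⬝ᵥ v = c) → y = 0) :
    Function.Injective fun x => ∑ k ∈ I, t k • gibbsMean (S k) (w k) x := by
  intro x y hxy
  have h1 : (x - y) ⬝ᵥ (∑ k ∈ I, t k • gibbsMean (S k) (w k) x -
      ∑ k ∈ I, t k • gibbsMean (S k) (w k) y) = 0 := by
    rw [sub_eq_zero.2 hxy, dotProduct_zero]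
  rw [← Finset.sum_sub_distrib, dotProduct_sum] at h1
  have h2 : ∀ k ∈ I, 0 ≤ (x - y) ⬝ᵥ
      (t k • gibbsMean (S k) (w k) x - t k • gibbsMean (S k) (w k) y) := fun k _ => by
    rw [← smul_sub, dotProduct_smul]
    exact mul_nonneg (ht k) (gibbsMean_sub_dot (hS k) (hw k) x y).1
  refine sub_eq_zero.1 (hI _ fun k hk hk0 => ?_)
  have h3 := (Finset.sum_eq_zero_iff_of_nonneg h2).1 h1 k hk
  rw [← smul_sub, dotProduct_smul, smul_eq_mul] at h3
  exact (gibbsMean_sub_dot (hS k) (hw k) x y).2 ((mul_eq_zero.1 h3).resolve_left hk0)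

variable [DecidableEq ι]

/-- To hit `p`, minimize the potential minus `x ⬝ᵥ p`: at a minimum the gradient of the potential
equals `p`. A minimum exists because a ball around `p` inside the body forces linear growth. -/
theorem interior_subset_range_sum_smul_gibbsMean (hS : ∀ k, (S k).Nonempty)
    (hw : ∀ k, ∀ v ∈ S k, 0 < w k v) (ht : ∀ k, 0 ≤ t k) :
    interior ((∑ k ∈ I, t k • polytope (S k) (hS k) : ConvexBody (ι → ℝ)) : Set (ι → ℝ)) ⊆
      Set.range fun x => ∑ k ∈ I, t k • gibbsMean (S k) (w k) x := by
  intro p hp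
  choose C hC using fun k => exists_dot_le_log_partFun (hw k)
  set Φ : (ι → ℝ) → ℝ := fun x => ∑ k ∈ I, t k * Real.log (partFun (S k) (w k) x) - x ⬝ᵥ p with hΦ
  have hdot : ∀ x, ∀ q ∈ ((∑ k ∈ I, t k • polytope (S k) (hS k) : ConvexBody (ι → ℝ)) :
      Set (ι → ℝ)), x ⬝ᵥ q - x ⬝ᵥ p ≤ Φ x + ∑ k ∈ I, t k * C k := by
    intro x q hq
    obtain ⟨g, hg, rfl⟩ := mem_sum_smul_polytope.1 hq
    rw [dotProduct_sum, hΦ]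
    have : ∑ k ∈ I, x ⬝ᵥ (t k • g k) ≤
        ∑ k ∈ I, t k * Real.log (partFun (S k) (w k) x) + ∑ k ∈ I, t k * C k := by
      rw [← Finset.sum_add_distrib]
      refine Finset.sum_le_sum fun k hk => ?_
      rw [dotProduct_smul, smul_eq_mul, ← mul_add]
      exact mul_le_mul_of_nonneg_left (hC k x _ (hg k hk)) (ht k)
    simp only
    linarith
  obtain ⟨r, hr, hball⟩ := Metric.mem_nhds_iff.1 (mem_interior_iff_mem_nhds.1 hp)
  have hcoer : ∀ x, r / 2 * ‖x‖ ≤ Φ x + ∑ k ∈ I, t k * C k := by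
    intro x
    have h0 : 0 ≤ Φ x + ∑ k ∈ I, t k * C k := by
      simpa using hdot x p (hball (Metric.mem_ball_self hr))
    rw [← le_div_iff₀' (by positivity), pi_norm_le_iff_of_nonneg (by positivity)]
    intro a
    rw [le_div_iff₀' (by positivity), Real.norm_eq_abs]
    -- Testing `hdot` at `p` shifted by `s` along one axis bounds one coordinate of `x`; the radius
    -- `r / 2` keeps the shifted point inside the open ball.
    have h1 : ∀ s : ℝ, |s| ≤ r / 2 → s * x a ≤ Φ x + ∑ k ∈ I, t k * C k := by
      intro s hs
      have hq : p + Pi.single a s ∈ Metric.ball p r := by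
        rw [mem_ball_iff_norm, add_sub_cancel_left, Pi.norm_single, Real.norm_eq_abs]
        linarith
      have h2 := hdot x _ (hball hq)
      rw [dotProduct_add, dotProduct_single] at h2
      linarith
    rcases le_total 0 (x a) with h | h
    · rw [abs_of_nonneg h]
      exact h1 _ (abs_of_pos (by positivity)).le
    · rw [abs_of_nonpos h]
      have := h1 (-(r / 2)) (by rw [abs_neg]; exact (abs_of_pos (by positivity)).le)
      linarith
  have hder : ∀ x, HasFDerivAt Φ (∑ k ∈ I, t k • dotCLM (gibbsMean (S k) (w k) x) - dotCLM p) x :=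
    fun x => (HasFDerivAt.fun_sum fun k _ =>
      (hasFDerivAt_log_partFun (hS k) (hw k) x).const_mul (t k)).sub (hasFDerivAt_dot p x)
  have hcont : Continuous Φ := continuous_iff_continuousAt.2 fun x => (hder x).continuousAt
  have hlim : Filter.Tendsto Φ (Filter.cocompact _) Filter.atTop := by
    have h1 : Filter.Tendsto (fun x : ι → ℝ => r / 2 * ‖x‖ - ∑ k ∈ I, t k * C k)
        (Filter.cocompact _) Filter.atTop :=
      Filter.tendsto_atTop_add_const_right _ _
        ((tendsto_norm_cocompact_atTop).const_mul_atTop (by positivity))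
    refine Filter.tendsto_atTop_mono (fun x => ?_) h1
    linarith [hcoer x]
  obtain ⟨x, hx⟩ := hcont.exists_forall_le hlim
  have h0 := IsLocalMin.hasFDerivAt_eq_zero (Filter.Eventually.of_forall hx) (hder x)
  refine ⟨x, ?_⟩
  funext a
  have h1 := congrArg (fun L : (ι → ℝ) →L[ℝ] ℝ => L (Pi.single a 1)) h0
  simp only [_root_.sub_apply, _root_.sum_apply, _root_.smul_apply,
    dotCLM_apply, single_dotProduct, one_mul, smul_eq_mul, _root_.zero_apply] at h1
  simp only [Finset.sum_apply, Pi.smul_apply, smul_eq_mul]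
  linarith

/-- The volume of a Minkowski combination of polytopes, as the total mass of the Monge-Ampère
measure of the corresponding combination of log-sum-exp functions. -/
theorem volume_sum_smul_polytope (hS : ∀ k, (S k).Nonempty)
    (hw : ∀ k, ∀ v ∈ S k, 0 < w k v) (ht : ∀ k, 0 ≤ t k) :
    volume ((∑ k ∈ I, t k • polytope (S k) (hS k) : ConvexBody (ι → ℝ)) : Set (ι → ℝ)) =
      ∫⁻ x, ENNReal.ofReal (∑ k ∈ I, t k • gibbsCov (S k) (w k) x).det := by
  set K : ConvexBody (ι → ℝ) := ∑ k ∈ I, t k • polytope (S k) (hS k) with hK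
  by_cases hI : ∀ y : ι → ℝ, (∀ k ∈ I, t k ≠ 0 → ∃ c, ∀ v ∈ S k, y ⬝ᵥ v = c) → y = 0
  · have hder : ∀ x, HasFDerivAt (fun x => ∑ k ∈ I, t k • gibbsMean (S k) (w k) x)
        (LinearMap.toContinuousLinearMap
          (Matrix.toLin' (∑ k ∈ I, t k • gibbsCov (S k) (w k) x))) x := by
      intro x
      have h1 := HasFDerivAt.fun_sum (u := I) fun k _ =>
        (hasFDerivAt_gibbsMean (hS k) (hw k) x).const_smul (t k)
      convert! h1 using 1
      simp [map_sum]
    have h2 := lintegral_abs_det_fderiv_eq_addHaar_image volume MeasurableSet.univ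
      (fun x _ => (hder x).hasFDerivWithinAt)
      (injective_sum_smul_gibbsMean hS hw ht hI).injOn
    rw [Set.image_univ, Measure.restrict_univ] at h2
    -- The image of the gradient map lies between the interior of `K` and `K`, and the frontier of a
    -- convex set is a null set.
    have h3 : volume (K : Set (ι → ℝ)) =
        volume (Set.range fun x => ∑ k ∈ I, t k • gibbsMean (S k) (w k) x) := by
      refine le_antisymm ?_ (measure_mono ?_)
      · calc volume (K : Set (ι → ℝ)) ≤ volume (interior (K : Set (ι → ℝ)) ∪
              frontier (K : Set (ι → ℝ))) := measure_mono (by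
                rw [← closure_eq_interior_union_frontier]; exact subset_closure)
          _ ≤ volume (interior (K : Set (ι → ℝ))) + volume (frontier (K : Set (ι → ℝ))) :=
                measure_union_le _ _
          _ = volume (interior (K : Set (ι → ℝ))) := by
                rw [K.convex.addHaar_frontier volume, add_zero]
          _ ≤ _ := measure_mono (interior_subset_range_sum_smul_gibbsMean hS hw ht)
      · rintro _ ⟨x, rfl⟩
        exact mem_sum_smul_polytope.2
          ⟨_, fun k _ => gibbsMean_mem_convexHull (hS k) (hw k) x, rfl⟩
    rw [h3, ← h2]
    refine lintegral_congr fun x => ?_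
    rw [LinearMap.det_toContinuousLinearMap, LinearMap.det_toLin',
      abs_of_pos (sum_smul_gibbsCov_posDef hw ht hI x).det_pos]
  -- Degenerate case, where both sides vanish: `y` lies in the kernel of every Hessian, and `K` lies
  -- in a hyperplane orthogonal to `y`.
  · push Not at hI
    obtain ⟨y, hy, hy0⟩ := hI
    have hdet : ∀ x, (∑ k ∈ I, t k • gibbsCov (S k) (w k) x).det = 0 := by
      intro x
      refine Matrix.exists_mulVec_eq_zero_iff.1 ⟨y, hy0, ?_⟩
      rw [Matrix.sum_mulVec]
      refine Finset.sum_eq_zero fun k hk => ?_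
      by_cases hk0 : t k = 0
      · simp [hk0]
      obtain ⟨c, hc⟩ := hy k hk hk0
      rw [Matrix.smul_mulVec]
      refine smul_eq_zero_of_right _ ?_
      funext a
      rw [gibbsCov_mulVec]
      refine Finset.sum_eq_zero fun v hv => ?_
      rw [dotProduct_sub, hc v hv, dot_gibbsMean_of_const (hS k) (hw k) x hc, sub_self, mul_zero]
    simp only [hdet, ENNReal.ofReal_zero, lintegral_zero]
    have hc : ∃ c, ∀ q ∈ (K : Set (ι → ℝ)), y ⬝ᵥ q = c := by
      have : ∀ k, ∃ c, k ∈ I → ∀ q ∈ convexHull ℝ (S k : Set (ι → ℝ)), y ⬝ᵥ (t k • q) = c := by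
        intro k
        by_cases hk : k ∈ I
        · by_cases hk0 : t k = 0
          · exact ⟨0, fun _ q _ => by simp [hk0]⟩
          obtain ⟨c, hc⟩ := hy k hk hk0
          refine ⟨t k * c, fun _ q hq => ?_⟩
          have h1 : Convex ℝ {q : ι → ℝ | y ⬝ᵥ q = c} :=
            convex_hyperplane ⟨fun a b => dotProduct_add y a b, fun s a => dotProduct_smul s y a⟩ c
          have h2 : y ⬝ᵥ q = c := convexHull_min (fun v hv => hc v hv) h1 hq
          rw [dotProduct_smul, h2, smul_eq_mul]
        · exact ⟨0, fun h => absurd h hk⟩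
      choose c hc using this
      refine ⟨∑ k ∈ I, c k, fun q hq => ?_⟩
      obtain ⟨g, hg, rfl⟩ := mem_sum_smul_polytope.1 hq
      rw [dotProduct_sum]
      exact Finset.sum_congr rfl fun k hk => hc k hk _ (hg k hk)
    obtain ⟨c, hc⟩ := hc
    obtain ⟨p, hp⟩ := K.nonempty
    refine measure_mono_null (t := (AffineSubspace.mk' p (LinearMap.ker (dotCLM y).toLinearMap) :
      Set (ι → ℝ))) (fun q hq => ?_) (Measure.addHaar_affineSubspace _ _ fun htop => ?_)
    · rw [SetLike.mem_coe, AffineSubspace.mem_mk', LinearMap.mem_ker]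
      have h1 := hc q hq
      have h2 := hc p hp
      rw [dotProduct_comm] at h1 h2
      simp [sub_dotProduct, h1, h2]
    · have h1 : p + y ∈ AffineSubspace.mk' p (LinearMap.ker (dotCLM y).toLinearMap) := by
        rw [htop]
        exact AffineSubspace.mem_top _ _ _
      rw [AffineSubspace.mem_mk', LinearMap.mem_ker] at h1
      simp [dotProduct_self_eq_zero] at h1
      exact hy0 h1

end PolytopeVolume

/-! ### Mixed volumes of polytopes as integrals of mixed discriminants. -/

section PolytopeMixedVolume

open Finset Filter Topology

variable {ι : Type*} [Fintype ι] {S : ι → Finset (ι → ℝ)} {w : ι → (ι → ℝ) → ℝ} {t : ι → ℝ}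

theorem det_sum_smul_gibbsCov_nonneg [DecidableEq ι] (hw : ∀ i, ∀ v ∈ S i, 0 < w i v)
    (ht : ∀ i, 0 ≤ t i) (I : Finset ι) (x : ι → ℝ) :
    0 ≤ (∑ i ∈ I, t i • gibbsCov (S i) (w i) x).det := by
  refine (Matrix.PosSemidef.of_dotProduct_mulVec_nonneg ?_ fun y => ?_).det_nonneg
  · rw [Matrix.IsHermitian, Matrix.conjTranspose_eq_transpose_of_trivial, Matrix.transpose_sum]
    exact Finset.sum_congr rfl fun k _ => by
      rw [Matrix.transpose_smul, (gibbsCov_isSymm x).eq]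
  · rw [star_trivial, dot_sum_smul_gibbsCov_mulVec]
    exact Finset.sum_nonneg fun i _ => mul_nonneg (ht i) (Finset.sum_nonneg fun v hv =>
      mul_nonneg (gibbs_pos (hw i) x hv).le (sq_nonneg _))

theorem continuous_sum_smul_gibbsCov (hw : ∀ i, ∀ v ∈ S i, 0 < w i v) (I : Finset ι) :
    Continuous fun x => ∑ i ∈ I, t i • gibbsCov (S i) (w i) x :=
  continuous_finsetSum _ fun i _ => (continuous_gibbsCov (hw i)).const_smul (t i)

theorem integral_det_sum_smul_gibbsCov [DecidableEq ι] (hS : ∀ i, (S i).Nonempty)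
    (hw : ∀ i, ∀ v ∈ S i, 0 < w i v) (ht : ∀ i, 0 ≤ t i) (I : Finset ι) :
    Integrable (fun x => (∑ i ∈ I, t i • gibbsCov (S i) (w i) x).det) ∧
      volume.real ((∑ i ∈ I, t i • polytope (S i) (hS i) : ConvexBody (ι → ℝ)) : Set (ι → ℝ)) =
        ∫ x, (∑ i ∈ I, t i • gibbsCov (S i) (w i) x).det := by
  have hc : Continuous fun x => (∑ i ∈ I, t i • gibbsCov (S i) (w i) x).det :=
    (continuous_sum_smul_gibbsCov hw I).matrix_det
  have h0 := fun x => det_sum_smul_gibbsCov_nonneg hw ht I x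
  have hv := volume_sum_smul_polytope (I := I) hS hw ht
  constructor
  · refine ⟨hc.aestronglyMeasurable, ?_⟩
    rw [hasFiniteIntegral_iff_ofReal (ae_of_all _ h0), ← hv]
    exact (ConvexBody.isCompact _).measure_lt_top
  · rw [integral_eq_lintegral_of_nonneg_ae (ae_of_all _ h0) hc.aestronglyMeasurable, ← hv]
    rfl

theorem mixedDisc_gibbsCov [DecidableEq ι] (S : ι → Finset (ι → ℝ)) (w : ι → (ι → ℝ) → ℝ)
    (x : ι → ℝ) : mixedDisc (fun i => gibbsCov (S i) (w i) x) =
      ∑ j ∈ Fintype.piFinset S, (∏ i, gibbs (S i) (w i) x (j i)) *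
        (Matrix.det (Matrix.of fun i => j i - gibbsMean (S i) (w i) x)) ^ 2 :=
  mixedDisc_sum_rankOne S (fun i v => gibbs (S i) (w i) x v)
    (fun i v => v - gibbsMean (S i) (w i) x) _ fun _ _ _ => rfl

theorem mixedDisc_gibbsCov_term_nonneg [DecidableEq ι] (hw : ∀ i, ∀ v ∈ S i, 0 < w i v)
    (x : ι → ℝ) {j : ι → ι → ℝ} (hj : j ∈ Fintype.piFinset S) :
    0 ≤ (∏ i, gibbs (S i) (w i) x (j i)) *
        (Matrix.det (Matrix.of fun i => j i - gibbsMean (S i) (w i) x)) ^ 2 :=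
  mul_nonneg (Finset.prod_nonneg fun i _ =>
    (gibbs_pos (hw i) x (Fintype.mem_piFinset.1 hj i)).le) (sq_nonneg _)

theorem mixedDisc_gibbsCov_nonneg [DecidableEq ι] (hw : ∀ i, ∀ v ∈ S i, 0 < w i v) (x : ι → ℝ) :
    0 ≤ mixedDisc (fun i => gibbsCov (S i) (w i) x) := by
  rw [mixedDisc_gibbsCov]
  exact Finset.sum_nonneg fun j hj => mixedDisc_gibbsCov_term_nonneg hw x hj

theorem continuous_mixedDisc_gibbsCov [DecidableEq ι] (hw : ∀ i, ∀ v ∈ S i, 0 < w i v) :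
    Continuous fun x => mixedDisc (fun i => gibbsCov (S i) (w i) x) :=
  continuous_mixedDisc.comp (continuous_pi fun i => continuous_gibbsCov (hw i))

theorem mixedVolume_smul_polytope_aux [DecidableEq ι] (hS : ∀ i, (S i).Nonempty)
    (hw : ∀ i, ∀ v ∈ S i, 0 < w i v) (ht : ∀ i, 0 ≤ t i) :
    Integrable (fun x => mixedDisc (fun i => t i • gibbsCov (S i) (w i) x)) ∧
    mixedVolume volume (fun i => t i • polytope (S i) (hS i)) =
      ((Fintype.card ι).factorial : ℝ)⁻¹ *
        ∫ x, mixedDisc (fun i => t i • gibbsCov (S i) (w i) x) := by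
  have h := fun I => integral_det_sum_smul_gibbsCov hS hw ht I
  simp_rw [← sum_neg_one_pow_det]
  refine ⟨integrable_finsetSum _ fun I _ => (h I).1.const_mul _, ?_⟩
  rw [mixedVolume, integral_finsetSum _ fun I _ => (h I).1.const_mul _]
  congr 1
  refine Finset.sum_congr rfl fun I _ => ?_
  rw [(h I).2, integral_const_mul]

/-- The left-hand side does not involve `w`, so the integral is the same for all positive weights.
Monotonicity rests on this freedom. -/
theorem mixedVolume_polytope [DecidableEq ι] (hS : ∀ i, (S i).Nonempty)
    (hw : ∀ i, ∀ v ∈ S i, 0 < w i v) :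
    Integrable (fun x => mixedDisc (fun i => gibbsCov (S i) (w i) x)) ∧
    mixedVolume volume (fun i => polytope (S i) (hS i)) =
      ((Fintype.card ι).factorial : ℝ)⁻¹ *
        ∫ x, mixedDisc (fun i => gibbsCov (S i) (w i) x) := by
  simpa using mixedVolume_smul_polytope_aux hS hw (t := fun _ => 1) fun _ => zero_le_one

theorem mixedVolume_polytope_nonneg (hS : ∀ i, (S i).Nonempty) :
    0 ≤ mixedVolume volume (fun i => polytope (S i) (hS i)) := by
  classical
  rw [(mixedVolume_polytope hS (w := fun _ _ => 1) fun _ _ _ => one_pos).2]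
  exact mul_nonneg (by positivity)
    (integral_nonneg fun x => mixedDisc_gibbsCov_nonneg (fun _ _ _ => one_pos) x)

theorem mixedVolume_smul_polytope (hS : ∀ i, (S i).Nonempty) (ht : ∀ i, 0 ≤ t i) :
    mixedVolume volume (fun i => t i • polytope (S i) (hS i)) =
      (∏ i, t i) * mixedVolume volume (fun i => polytope (S i) (hS i)) := by
  classical
  rw [(mixedVolume_polytope hS (w := fun _ _ => 1) fun _ _ _ => one_pos).2,
    (mixedVolume_smul_polytope_aux hS (w := fun _ _ => 1) (fun _ _ _ => one_pos) ht).2]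
  simp_rw [mixedDisc_smul]
  rw [integral_const_mul]
  ring

/-- Gibbs covariances depend continuously on the weights, also where weights vanish. -/
theorem tendsto_gibbsCov_of_subset {S S' : Finset (ι → ℝ)} (hS : S.Nonempty) (h : S ⊆ S')
    {wn : ℕ → (ι → ℝ) → ℝ} (h1 : ∀ n, ∀ v ∈ S, wn n v = 1)
    (h0 : ∀ v ∉ S, Tendsto (fun n => wn n v) atTop (𝓝 0)) (x : ι → ℝ) :
    Tendsto (fun n => gibbsCov S' (wn n) x) atTop (𝓝 (gibbsCov S (fun _ => 1) x)) := by
  classical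
  -- These are the limit weights. On the larger set `S'` they reproduce mean and covariance of `S`
  -- with unit weights.
  set w0 : (ι → ℝ) → ℝ := fun v => if v ∈ S then 1 else 0 with hw0
  have hlim : ∀ v, Tendsto (fun n => wn n v) atTop (𝓝 (w0 v)) := by
    intro v
    by_cases hv : v ∈ S
    · simp [hw0, hv, h1 _ v hv]
    · simpa [hw0, hv] using h0 v hv
  have hZ : partFun S' w0 x = partFun S (fun _ => 1) x := by
    simp only [partFun, hw0, ite_mul, zero_mul]
    rw [Finset.sum_ite_mem, Finset.inter_eq_right.2 h]
  have hZpos : partFun S' w0 x ≠ 0 := by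
    rw [hZ]
    exact (partFun_pos hS (fun _ _ => one_pos) x).ne'
  have hg : ∀ v, gibbs S' w0 x v = if v ∈ S then gibbs S (fun _ => 1) x v else 0 := by
    intro v
    rw [gibbs, gibbs, hZ]
    by_cases hv : v ∈ S <;> simp [hw0, hv]
  have hm : gibbsMean S' w0 x = gibbsMean S (fun _ => 1) x := by
    simp only [gibbsMean, hg, ite_smul, zero_smul]
    rw [Finset.sum_ite_mem, Finset.inter_eq_right.2 h]
  have hcov : gibbsCov S' w0 x = gibbsCov S (fun _ => 1) x := by
    ext a b
    simp only [gibbsCov, hg, hm, ite_mul, zero_mul]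
    rw [Finset.sum_ite_mem, Finset.inter_eq_right.2 h]
  rw [← hcov]
  have tZ : Tendsto (fun n => partFun S' (wn n) x) atTop (𝓝 (partFun S' w0 x)) :=
    tendsto_finsetSum _ fun v _ => (hlim v).mul_const _
  have tg : ∀ v, Tendsto (fun n => gibbs S' (wn n) x v) atTop (𝓝 (gibbs S' w0 x v)) := fun v =>
    ((hlim v).mul_const _).div tZ hZpos
  have tm : Tendsto (fun n => gibbsMean S' (wn n) x) atTop (𝓝 (gibbsMean S' w0 x)) :=
    tendsto_finsetSum _ fun v _ => (tg v).smul_const v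
  have tma : ∀ v a, Tendsto (fun n => (v - gibbsMean S' (wn n) x) a) atTop
      (𝓝 ((v - gibbsMean S' w0 x) a)) := fun v a =>
    tendsto_pi_nhds.1 (tm.const_sub v) a
  refine tendsto_pi_nhds.2 fun a => tendsto_pi_nhds.2 fun b => ?_
  exact tendsto_finsetSum _ fun v _ => ((tg v).mul (tma v a)).mul (tma v b)

/-- Give the points of `S' i` outside `S i` weights tending to zero. The integrals stay equal to the
larger mixed volume (up to `N!`), while the non-negative integrands converge pointwise to those of
the smaller one; Fatou's lemma gives the inequality. -/
theorem mixedVolume_polytope_mono {S S' : ι → Finset (ι → ℝ)} (hS : ∀ i, (S i).Nonempty)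
    (hS' : ∀ i, (S' i).Nonempty) (h : ∀ i, S i ⊆ S' i) :
    mixedVolume volume (fun i => polytope (S i) (hS i)) ≤
      mixedVolume volume (fun i => polytope (S' i) (hS' i)) := by
  classical
  set wn : ℕ → ι → (ι → ℝ) → ℝ := fun n i v => if v ∈ S i then 1 else 1 / ((n : ℝ) + 1) with hwn
  have hpos : ∀ n i, ∀ v ∈ S' i, 0 < wn n i v := by
    intro n i v _
    simp only [hwn]
    split_ifs <;> positivity
  have hF : ∀ n, mixedVolume volume (fun i => polytope (S' i) (hS' i)) =
      ((Fintype.card ι).factorial : ℝ)⁻¹ *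
        ∫ x, mixedDisc (fun i => gibbsCov (S' i) (wn n i) x) := fun n =>
    (mixedVolume_polytope hS' (hpos n)).2
  rw [(mixedVolume_polytope hS (w := fun _ _ => 1) fun _ _ _ => one_pos).2, hF 0]
  refine mul_le_mul_of_nonneg_left ?_ (by positivity)
  have hconst : ∀ n, ∫ x, mixedDisc (fun i => gibbsCov (S' i) (wn n i) x) =
      ∫ x, mixedDisc (fun i => gibbsCov (S' i) (wn 0 i) x) := by
    intro n
    have h1 := (hF n).symm.trans (hF 0)
    have h2 : ((Fintype.card ι).factorial : ℝ)⁻¹ ≠ 0 := by positivity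
    exact mul_left_cancel₀ h2 h1
  have hlim : ∀ x, Tendsto (fun n => mixedDisc (fun i => gibbsCov (S' i) (wn n i) x)) atTop
      (𝓝 (mixedDisc fun i => gibbsCov (S i) (fun _ => 1) x)) := by
    intro x
    refine (continuous_mixedDisc.tendsto _).comp (tendsto_pi_nhds.2 fun i => ?_)
    refine tendsto_gibbsCov_of_subset (hS i) (h i) ?_ ?_ x
    · intro n v hv
      simp [hwn, hv]
    · intro v hv
      simpa [hwn, hv] using tendsto_one_div_add_atTop_nhds_zero_nat (𝕜 := ℝ)
  have hcn := fun n => continuous_mixedDisc_gibbsCov (hpos n)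
  have hc1 := continuous_mixedDisc_gibbsCov (S := S) (w := fun _ _ => 1) fun _ _ _ => one_pos
  have h0n := fun n x => mixedDisc_gibbsCov_nonneg (hpos n) x
  have h01 := fun x => mixedDisc_gibbsCov_nonneg (S := S) (w := fun _ _ => 1)
    (fun _ _ _ => one_pos) x
  have hfat : ∫⁻ x, ENNReal.ofReal (mixedDisc fun i => gibbsCov (S i) (fun _ => 1) x) ≤
      ENNReal.ofReal (∫ x, mixedDisc (fun i => gibbsCov (S' i) (wn 0 i) x)) := by
    calc _ = ∫⁻ x, liminf (fun n => ENNReal.ofReal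
          (mixedDisc (fun i => gibbsCov (S' i) (wn n i) x))) atTop :=
        lintegral_congr fun x => ((ENNReal.tendsto_ofReal (hlim x)).liminf_eq).symm
      _ ≤ liminf (fun n => ∫⁻ x, ENNReal.ofReal
          (mixedDisc (fun i => gibbsCov (S' i) (wn n i) x))) atTop :=
        lintegral_liminf_le fun n => (hcn n).measurable.ennreal_ofReal
      _ = liminf (fun _ : ℕ => ENNReal.ofReal
            (∫ x, mixedDisc (fun i => gibbsCov (S' i) (wn 0 i) x))) atTop := by
        congr 1
        funext n
        rw [← hconst n, ofReal_integral_eq_lintegral_ofReal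
          (mixedVolume_polytope hS' (hpos n)).1 (ae_of_all _ (h0n n))]
      _ = _ := by simp
  rw [← ofReal_integral_eq_lintegral_ofReal
    (mixedVolume_polytope hS fun _ _ _ => one_pos).1 (ae_of_all _ h01)] at hfat
  exact (ENNReal.ofReal_le_ofReal_iff (integral_nonneg (h0n 0))).1 hfat

/-- A positive integral has a non-zero integrand at some `z`, hence a non-zero determinant with rows
`j i` minus the mean of `S i`. Both the vertex and the mean belong to the polytope, so each row is
the direction of a segment in it. -/
theorem exists_linearIndependent_of_mixedVolume_polytope_pos (hS : ∀ i, (S i).Nonempty)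
    (h : 0 < mixedVolume volume (fun i => polytope (S i) (hS i))) :
    ∃ x y : ι → ι → ℝ, (∀ i, x i ∈ (polytope (S i) (hS i) : Set (ι → ℝ))) ∧
      (∀ i, y i ∈ (polytope (S i) (hS i) : Set (ι → ℝ))) ∧
      LinearIndependent ℝ fun i => y i - x i := by
  classical
  have hw : ∀ i, ∀ v ∈ S i, (0 : ℝ) < (fun _ _ => 1 : ι → (ι → ℝ) → ℝ) i v :=
    fun _ _ _ => one_pos
  rw [(mixedVolume_polytope hS hw).2] at h
  have h1 : ∃ z, mixedDisc (fun i => gibbsCov (S i) (fun _ => 1) z) ≠ 0 := by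
    by_contra! h1
    simp [h1] at h
  obtain ⟨z, hz⟩ := h1
  rw [mixedDisc_gibbsCov S (fun _ _ => 1)] at hz
  obtain ⟨j, hj, hne⟩ := Finset.exists_ne_zero_of_sum_ne_zero hz
  have hdet := (mul_ne_zero_iff.1 hne).2
  rw [Fintype.mem_piFinset] at hj
  refine ⟨fun i => gibbsMean (S i) (fun _ => 1) z, j,
    fun i => gibbsMean_mem_convexHull (hS i) (hw i) z, fun i => subset_convexHull ℝ _ (hj i), ?_⟩
  have := Matrix.linearIndependent_rows_iff_isUnit (K := ℝ)
    (A := Matrix.of fun i => j i - gibbsMean (S i) (fun _ => 1) z)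
  refine this.2 ((Matrix.isUnit_iff_isUnit_det _).2 (isUnit_iff_ne_zero.2 ?_))
  exact fun h0 => hdet (by rw [h0]; simp)

theorem mixedVolume_polytope_pair_pos [DecidableEq (ι → ℝ)] {x y : ι → ι → ℝ}
    (h : LinearIndependent ℝ fun i => y i - x i) :
    0 < mixedVolume volume
      (fun i => polytope {x i, y i} (Finset.insert_nonempty (x i) {y i})) := by
  classical
  have hS : ∀ i, ({x i, y i} : Finset (ι → ℝ)).Nonempty := fun i => Finset.insert_nonempty _ _
  have hw : ∀ i, ∀ v ∈ ({x i, y i} : Finset (ι → ℝ)),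
    (0 : ℝ) < (fun _ _ => 1 : ι → (ι → ℝ) → ℝ) i v := fun _ _ _ => one_pos
  have hV := mixedVolume_polytope hS hw
  rw [hV.2]
  have hpos : ∀ z, 0 < mixedDisc
      (fun i => gibbsCov ({x i, y i} : Finset (ι → ℝ)) (fun _ => 1) z) := by
    intro z
    rw [mixedDisc_gibbsCov (fun i => ({x i, y i} : Finset (ι → ℝ))) (fun _ _ => 1)]
    have hy : y ∈ Fintype.piFinset fun i => ({x i, y i} : Finset (ι → ℝ)) := by
      simp [Fintype.mem_piFinset]
    refine Finset.sum_pos' (fun j hj => mixedDisc_gibbsCov_term_nonneg hw z hj) ⟨y, hy, ?_⟩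
    have hne : ∀ i, x i ≠ y i := fun i hi => h.ne_zero i (by simp [hi])
    -- The two weights sum to one, so the row at `y i` is a positive multiple of `y i - x i`. The
    -- summand for the choice `y` is thus positive at every `z`.
    have e : ∀ i, y i - gibbsMean ({x i, y i} : Finset (ι → ℝ)) (fun _ => 1) z =
        gibbs ({x i, y i} : Finset (ι → ℝ)) (fun _ => 1) z (x i) • (y i - x i) := by
      intro i
      have h1 := sum_gibbs (hS i) (hw i) z
      rw [Finset.sum_pair (hne i)] at h1
      rw [gibbsMean, Finset.sum_pair (hne i)]
      have h2 : gibbs ({x i, y i} : Finset (ι → ℝ)) (fun _ => 1) z (y i) =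
        1 - gibbs ({x i, y i} : Finset (ι → ℝ)) (fun _ => 1) z (x i) := by linarith
      rw [h2]
      module
    have hp : ∀ i, ∀ v ∈ ({x i, y i} : Finset (ι → ℝ)),
      0 < gibbs ({x i, y i} : Finset (ι → ℝ)) (fun _ => 1) z v := fun i v hv =>
      gibbs_pos (hw i) z hv
    refine mul_pos (Finset.prod_pos fun i _ => hp i _ (by simp)) (sq_pos_iff.2 ?_)
    have hd : (Matrix.of fun i => y i - gibbsMean ({x i, y i} : Finset (ι → ℝ)) (fun _ => 1) z) =
        Matrix.of fun i j => gibbs ({x i, y i} : Finset (ι → ℝ)) (fun _ => 1) z (x i) *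
          (Matrix.of fun i => y i - x i) i j := by
      ext i j
      rw [Matrix.of_apply, e i]
      rfl
    rw [hd, Matrix.det_mul_column]
    refine mul_ne_zero (Finset.prod_ne_zero_iff.2 fun i _ => (hp i _ (by simp)).ne') ?_
    have := (Matrix.linearIndependent_rows_iff_isUnit (K := ℝ)
      (A := Matrix.of fun i => y i - x i)).1 h
    exact isUnit_iff_ne_zero.1 ((Matrix.isUnit_iff_isUnit_det _).1 this)
  refine mul_pos (by positivity) ((integral_pos_iff_support_of_nonneg
    (fun z => (hpos z).le) hV.1).2 ?_)
  rw [Function.support_eq_univ (by exact fun z => (hpos z).ne')]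
  exact Measure.measure_univ_pos.2 (NeZero.ne _)

end PolytopeMixedVolume

/-! ### From polytopes to convex bodies by increasing inner approximation. -/

section Approximation

open Filter Topology

variable {ι : Type*} [Fintype ι]

/-- The increasing union of the partial Minkowski sums is convex and dense in the full sum. Its
frontier is a null set, so the union already has the full volume, and continuity of the measure from
below applies. -/
theorem tendsto_volume_sum_body {κ : Type*} [Fintype κ] {P : ℕ → κ → ConvexBody (ι → ℝ)}
    {K : κ → ConvexBody (ι → ℝ)}
    (hmono : ∀ i, Monotone fun m => (P m i : Set (ι → ℝ)))
    (hsub : ∀ m i, (P m i : Set (ι → ℝ)) ⊆ K i)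
    (hdense : ∀ i, (K i : Set (ι → ℝ)) ⊆ closure (⋃ m, (P m i : Set (ι → ℝ)))) (I : Finset κ) :
    Tendsto (fun m => volume.real ((∑ i ∈ I, P m i : ConvexBody (ι → ℝ)) : Set (ι → ℝ))) atTop
      (𝓝 (volume.real ((∑ i ∈ I, K i : ConvexBody (ι → ℝ)) : Set (ι → ℝ)))) := by
  classical
  set Q : ℕ → Set (ι → ℝ) := fun m => ((∑ i ∈ I, P m i : ConvexBody (ι → ℝ)) : Set (ι → ℝ))
    with hQ
  have hQm : Monotone Q := fun m n hmn => sum_body_mono fun i _ => hmono i hmn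
  have hQK : ⋃ m, Q m ⊆ ((∑ i ∈ I, K i : ConvexBody (ι → ℝ)) : Set (ι → ℝ)) :=
    Set.iUnion_subset fun m => sum_body_mono fun i _ => hsub m i
  have hconv : Convex ℝ (⋃ m, Q m) :=
    hQm.directed_le.convex_iUnion fun m => ConvexBody.convex _
  have hcl : ((∑ i ∈ I, K i : ConvexBody (ι → ℝ)) : Set (ι → ℝ)) ⊆ closure (⋃ m, Q m) := by
    intro x hx
    obtain ⟨g, hg, rfl⟩ := mem_sum_body.1 hx
    -- A product of closures is the closure of the product, and summation is continuous. Coordinates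
    -- outside `I` do not enter the sum and are pinned to zero.
    have h1 : (fun i => if i ∈ I then g i else 0) ∈ closure (Set.pi Set.univ fun i =>
        if i ∈ I then ⋃ m, (P m i : Set (ι → ℝ)) else {0}) := by
      rw [closure_pi_set]
      intro i _
      by_cases hi : i ∈ I
      · simpa [hi] using hdense i (hg i hi)
      · simp [hi]
    have h2 : Continuous fun f : κ → ι → ℝ => ∑ i ∈ I, f i := by fun_prop
    have h3 := image_closure_subset_closure_image h2 (Set.mem_image_of_mem _ h1)
    have h4 : ∑ i ∈ I, (if i ∈ I then g i else 0) = ∑ i ∈ I, g i :=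
      Finset.sum_congr rfl fun i hi => if_pos hi
    rw [h4] at h3
    refine closure_mono ?_ h3
    rintro _ ⟨f, hf, rfl⟩
    have h5 : ∀ i, ∃ m, i ∈ I → f i ∈ (P m i : Set (ι → ℝ)) := by
      intro i
      by_cases hi : i ∈ I
      · have := hf i (Set.mem_univ i)
        simp only [hi, if_true] at this
        obtain ⟨m, hm⟩ := Set.mem_iUnion.1 this
        exact ⟨m, fun _ => hm⟩
      · exact ⟨0, fun h => absurd h hi⟩
    choose m hm using h5
    -- The sum of the indices serves as a common upper bound for all of them.
    refine Set.mem_iUnion.2 ⟨∑ i, m i, mem_sum_body.2 ⟨f, fun i hi => ?_, rfl⟩⟩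
    exact hmono i (Finset.single_le_sum (f := m) (fun _ _ => Nat.zero_le _) (Finset.mem_univ i))
      (hm i hi)
  have hvol : volume (⋃ m, Q m) =
      volume ((∑ i ∈ I, K i : ConvexBody (ι → ℝ)) : Set (ι → ℝ)) := by
    refine le_antisymm (measure_mono hQK) ?_
    calc _ ≤ volume (closure (⋃ m, Q m)) := measure_mono hcl
      _ ≤ volume ((⋃ m, Q m) ∪ frontier (⋃ m, Q m)) :=
          measure_mono (by rw [closure_eq_self_union_frontier])
      _ ≤ volume (⋃ m, Q m) + volume (frontier (⋃ m, Q m)) := measure_union_le _ _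
      _ = _ := by rw [hconv.addHaar_frontier volume, add_zero]
  have h := tendsto_measure_iUnion_atTop (μ := volume) hQm
  rw [hvol] at h
  exact (ENNReal.tendsto_toReal (ConvexBody.isCompact _).measure_lt_top.ne).comp h

theorem tendsto_mixedVolume {P : ℕ → ι → ConvexBody (ι → ℝ)} {K : ι → ConvexBody (ι → ℝ)}
    (hmono : ∀ i, Monotone fun m => (P m i : Set (ι → ℝ)))
    (hsub : ∀ m i, (P m i : Set (ι → ℝ)) ⊆ K i)
    (hdense : ∀ i, (K i : Set (ι → ℝ)) ⊆ closure (⋃ m, (P m i : Set (ι → ℝ)))) :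
    Tendsto (fun m => mixedVolume volume (P m)) atTop (𝓝 (mixedVolume volume K)) :=
  (tendsto_finsetSum _ fun I _ =>
    (tendsto_volume_sum_body hmono hsub hdense I).const_mul _).const_mul _

open Classical in
/-- The first points of a dense sequence in a convex body. -/
noncomputable def bodyPoints (K : ConvexBody (ι → ℝ)) (m : ℕ) : Finset (ι → ℝ) :=
  haveI : Nonempty (K : Set (ι → ℝ)) := K.nonempty.to_subtype
  (Finset.range (m + 1)).image fun j =>
    (TopologicalSpace.denseSeq (K : Set (ι → ℝ)) j : ι → ℝ)

theorem bodyPoints_nonempty (K : ConvexBody (ι → ℝ)) (m : ℕ) : (bodyPoints K m).Nonempty := by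
  simp [bodyPoints]

theorem bodyPoints_subset (K : ConvexBody (ι → ℝ)) (m : ℕ) :
    (bodyPoints K m : Set (ι → ℝ)) ⊆ K := by
  intro x hx
  simp only [bodyPoints, Finset.coe_image, Set.mem_image] at hx
  obtain ⟨j, _, rfl⟩ := hx
  exact Subtype.coe_prop _

theorem bodyPoints_mono (K : ConvexBody (ι → ℝ)) : Monotone (bodyPoints K) := fun m n h =>
  Finset.image_subset_image (Finset.range_mono (by lia))

theorem subset_closure_bodyPoints (K : ConvexBody (ι → ℝ)) :
    (K : Set (ι → ℝ)) ⊆ closure (⋃ m, (bodyPoints K m : Set (ι → ℝ))) := by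
  have : Nonempty (K : Set (ι → ℝ)) := K.nonempty.to_subtype
  intro x hx
  have h1 := TopologicalSpace.denseRange_denseSeq (K : Set (ι → ℝ)) ⟨x, hx⟩
  have h2 := image_closure_subset_closure_image continuous_subtype_val (Set.mem_image_of_mem _ h1)
  refine closure_mono ?_ h2
  rintro _ ⟨_, ⟨j, rfl⟩, rfl⟩
  refine Set.mem_iUnion.2 ⟨j, ?_⟩
  simp only [bodyPoints, Finset.coe_image]
  exact ⟨j, by simp, rfl⟩

/-- The sets `S m i` need only contain the chosen dense points. This leaves room for adding the
points of a smaller body, so that two approximations can be nested. -/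
theorem tendsto_mixedVolume_smul_polytope {S : ℕ → ι → Finset (ι → ℝ)}
    (hS : ∀ m i, (S m i).Nonempty) {K : ι → ConvexBody (ι → ℝ)} (t : ι → ℝ)
    (hmono : ∀ i, Monotone fun m => S m i) (hsub : ∀ m i, (S m i : Set (ι → ℝ)) ⊆ K i)
    (hle : ∀ m i, bodyPoints (K i) m ⊆ S m i) :
    Tendsto (fun m => mixedVolume volume (fun i => t i • polytope (S m i) (hS m i))) atTop
      (𝓝 (mixedVolume volume fun i => t i • K i)) := by
  refine tendsto_mixedVolume (fun i m n hmn => ?_) (fun m i => ?_) fun i => ?_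
  · simp only [ConvexBody.coe_smul]
    exact Set.smul_set_mono (convexHull_mono (Finset.coe_subset.2 (hmono i hmn)))
  · simp only [ConvexBody.coe_smul]
    exact Set.smul_set_mono (convexHull_min (hsub m i) (K i).convex)
  · simp only [ConvexBody.coe_smul]
    rintro _ ⟨x, hx, rfl⟩
    have h1 := image_closure_subset_closure_image (continuous_const_smul (t i))
      (Set.mem_image_of_mem _ (subset_closure_bodyPoints (K i) hx))
    refine closure_mono ?_ h1
    rintro _ ⟨v, hv, rfl⟩
    obtain ⟨m, hm⟩ := Set.mem_iUnion.1 hv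
    exact Set.mem_iUnion.2 ⟨m, Set.smul_mem_smul_set
      (subset_convexHull ℝ _ (Finset.coe_subset.2 (hle m i) hm))⟩

theorem tendsto_mixedVolume_polytope {S : ℕ → ι → Finset (ι → ℝ)}
    (hS : ∀ m i, (S m i).Nonempty) {K : ι → ConvexBody (ι → ℝ)}
    (hmono : ∀ i, Monotone fun m => S m i) (hsub : ∀ m i, (S m i : Set (ι → ℝ)) ⊆ K i)
    (hle : ∀ m i, bodyPoints (K i) m ⊆ S m i) :
    Tendsto (fun m => mixedVolume volume (fun i => polytope (S m i) (hS m i))) atTop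
      (𝓝 (mixedVolume volume K)) := by
  simpa using tendsto_mixedVolume_smul_polytope hS (fun _ => 1) hmono hsub hle

theorem tendsto_mixedVolume_bodyPoints (K : ι → ConvexBody (ι → ℝ)) :
    Tendsto (fun m => mixedVolume volume
      (fun i => polytope (bodyPoints (K i) m) (bodyPoints_nonempty (K i) m))) atTop
      (𝓝 (mixedVolume volume K)) :=
  tendsto_mixedVolume_polytope (S := fun m i => bodyPoints (K i) m)
    (fun m i => bodyPoints_nonempty (K i) m)
    (fun i => bodyPoints_mono (K i)) (fun m i => bodyPoints_subset (K i) m) fun _ _ => subset_rfl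

theorem mixedVolume_nonneg (K : ι → ConvexBody (ι → ℝ)) : 0 ≤ mixedVolume volume K :=
  ge_of_tendsto' (tendsto_mixedVolume_bodyPoints K) fun _ => mixedVolume_polytope_nonneg _

theorem mixedVolume_mono {K K' : ι → ConvexBody (ι → ℝ)}
    (h : ∀ i, (K i : Set (ι → ℝ)) ⊆ K' i) : mixedVolume volume K ≤ mixedVolume volume K' := by
  classical
  have h1 := tendsto_mixedVolume_polytope
    (S := fun m i => bodyPoints (K i) m ∪ bodyPoints (K' i) m) (K := K')
    (fun m i => (bodyPoints_nonempty (K i) m).mono Finset.subset_union_left)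
    (fun i m n hmn => Finset.union_subset_union (bodyPoints_mono _ hmn) (bodyPoints_mono _ hmn))
    (fun m i => by
      rw [Finset.coe_union]
      exact Set.union_subset ((bodyPoints_subset _ m).trans (h i)) (bodyPoints_subset _ m))
    fun m i => Finset.subset_union_right
  exact le_of_tendsto_of_tendsto' (tendsto_mixedVolume_bodyPoints K) h1 fun m =>
    mixedVolume_polytope_mono _ _ fun i => Finset.subset_union_left

theorem mixedVolume_smul (K : ι → ConvexBody (ι → ℝ)) {t : ι → ℝ} (ht : ∀ i, 0 ≤ t i) :
    mixedVolume volume (fun i => t i • K i) = (∏ i, t i) * mixedVolume volume K := by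
  have h1 := tendsto_mixedVolume_smul_polytope (S := fun m i => bodyPoints (K i) m) (K := K)
    (fun m i => bodyPoints_nonempty (K i) m) t
    (fun i => bodyPoints_mono (K i)) (fun m i => bodyPoints_subset (K i) m) fun _ _ => subset_rfl
  have h2 := (tendsto_mixedVolume_bodyPoints K).const_mul (∏ i, t i)
  refine tendsto_nhds_unique h1 (h2.congr fun m => ?_)
  exact (mixedVolume_smul_polytope _ ht).symm

/-- A mixed volume is positive iff the bodies contain segments in linearly independent
directions. -/
theorem mixedVolume_pos_iff (K : ι → ConvexBody (ι → ℝ)) :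
    0 < mixedVolume volume K ↔ ∃ x y : ι → ι → ℝ, (∀ i, x i ∈ (K i : Set (ι → ℝ))) ∧
      (∀ i, y i ∈ (K i : Set (ι → ℝ))) ∧ LinearIndependent ℝ fun i => y i - x i := by
  classical
  constructor
  · intro h
    -- Positivity of the limit is inherited by some inscribed polytopes, whose segments lie in `K`.
    obtain ⟨m, hm⟩ := ((tendsto_mixedVolume_bodyPoints K).eventually (lt_mem_nhds h)).exists
    obtain ⟨x, y, hx, hy, hxy⟩ := exists_linearIndependent_of_mixedVolume_polytope_pos _ hm
    have hP : ∀ i, (polytope (bodyPoints (K i) m) (bodyPoints_nonempty (K i) m) :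
        Set (ι → ℝ)) ⊆ K i := fun i => convexHull_min (bodyPoints_subset (K i) m) (K i).convex
    exact ⟨x, y, fun i => hP i (hx i), fun i => hP i (hy i), hxy⟩
  · rintro ⟨x, y, hx, hy, hxy⟩
    refine (mixedVolume_polytope_pair_pos hxy).trans_le (mixedVolume_mono fun i => ?_)
    refine convexHull_min ?_ (K i).convex
    intro v hv
    simp only [Finset.coe_insert, Finset.coe_singleton, Set.mem_insert_iff,
      Set.mem_singleton_iff] at hv
    rcases hv with rfl | rfl
    · exact hx i
    · exact hy i

end Approximation

/-! ### Continuity, valuation property and translation invariance. -/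

section VolumeOfBodies

open Filter Topology

variable {V E : Type*} [NormedAddCommGroup V] [NormedSpace ℝ V] [NormedAddCommGroup E]
  [NormedSpace ℝ E]

theorem exists_dist_le_of_mem_body (K L : ConvexBody E) {x : E} (hx : x ∈ (K : Set E)) :
    ∃ y ∈ (L : Set E), dist x y ≤ dist K L := by
  obtain ⟨y, hy, h⟩ := L.isCompact.exists_infDist_eq_dist L.nonempty x
  exact ⟨y, hy, h ▸ Metric.infDist_le_hausdorffDist_of_mem hx ConvexBody.hausdorffEDist_ne_top⟩

/-- An interior point of a convex body belongs to all convex bodies nearby. -/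
theorem mem_body_of_ball_subset {K₀ K : ConvexBody E} {x : E} {r : ℝ} (hr : 0 < r)
    (hx : Metric.ball x r ⊆ (K₀ : Set E)) (hK : dist K K₀ < r / 2) : x ∈ (K : Set E) := by
  by_contra hxK
  obtain ⟨f, u, hf, hu⟩ := geometric_hahn_banach_closed_point K.convex K.isClosed hxK
  have hf0 : 0 < ‖f‖ := by
    rw [norm_pos_iff]
    rintro rfl
    obtain ⟨a, ha⟩ := K.nonempty
    have := hf a ha
    simp only [_root_.zero_apply] at this hu
    linarith
  -- Moving from `x` by `r • y`, with `f y` above half the norm of `f`, stays in `K₀` but ends at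
  -- distance more than `r / 2` from `K`, against `hK`.
  obtain ⟨y, hy1, hy⟩ := f.exists_lt_apply_of_lt_opNorm (half_lt_self hf0)
  obtain ⟨y, hy1, hy⟩ : ∃ y, ‖y‖ < 1 ∧ ‖f‖ / 2 < f y := by
    rcases le_total 0 (f y) with h | h
    · exact ⟨y, hy1, by rwa [Real.norm_of_nonneg h] at hy⟩
    · exact ⟨-y, by rwa [norm_neg], by rwa [Real.norm_of_nonpos h, ← map_neg] at hy⟩
  have hz : x + r • y ∈ (K₀ : Set E) := hx (by
    rw [mem_ball_iff_norm, add_sub_cancel_left, norm_smul, Real.norm_of_nonneg hr.le]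
    nlinarith)
  obtain ⟨k, hk, hd⟩ := exists_dist_le_of_mem_body K₀ K hz
  rw [dist_comm K₀ K, dist_eq_norm] at hd
  have h1 : f (x + r • y - k) ≤ ‖f‖ * (r / 2) :=
    (le_abs_self _).trans ((f.le_opNorm _).trans
      (mul_le_mul_of_nonneg_left (hd.trans hK.le) hf0.le))
  have h2 := hf k hk
  rw [map_sub, map_add, map_smul, smul_eq_mul] at h1
  nlinarith

theorem eventually_mem_body_iff {K₀ : ConvexBody E} {x : E} (hx : x ∉ frontier (K₀ : Set E)) :
    ∀ᶠ K : ConvexBody E in 𝓝 K₀, x ∈ (K : Set E) ↔ x ∈ (K₀ : Set E) := by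
  by_cases hxK : x ∈ (K₀ : Set E)
  · have hxi : x ∈ interior (K₀ : Set E) := by
      by_contra h
      exact hx ⟨subset_closure hxK, h⟩
    obtain ⟨r, hr, hball⟩ := Metric.mem_nhds_iff.1 (mem_interior_iff_mem_nhds.1 hxi)
    filter_upwards [Metric.ball_mem_nhds K₀ (half_pos hr)] with K hK
    exact iff_of_true (mem_body_of_ball_subset hr hball hK) hxK
  · have hpos := (K₀.isClosed.notMem_iff_infDist_pos K₀.nonempty).1 hxK
    filter_upwards [Metric.ball_mem_nhds K₀ hpos] with K hK
    refine iff_of_false (fun h => ?_) hxK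
    obtain ⟨y, hy, hd⟩ := exists_dist_le_of_mem_body K K₀ h
    exact absurd (Metric.infDist_le_dist_of_mem hy) (not_le.2 (hd.trans_lt hK))

/-- A segment between two closed sets with convex union meets their intersection. -/
theorem exists_segment_mem_inter {A B : Set V} (hA : IsClosed A) (hB : IsClosed B)
    (h : Convex ℝ (A ∪ B)) {a b : V} (ha : a ∈ A) (hb : b ∈ B) :
    ∃ z ∈ segment ℝ a b, z ∈ A ∩ B := by
  have h1 := isPreconnected_closed_iff.1 (convex_segment (𝕜 := ℝ) a b).isPreconnected A B hA hB
    (h.segment_subset (Or.inl ha) (Or.inr hb)) ⟨a, left_mem_segment ℝ a b, ha⟩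
    ⟨b, right_mem_segment ℝ a b, hb⟩
  exact h1

theorem IsValuation.const_mul {φ : ConvexBody V → ℝ} (h : IsValuation φ) (c : ℝ) :
    IsValuation fun B => c * φ B := by
  intro A B C D hC hD
  simp only [h A B C D hC hD]
  ring

theorem IsValuation.sum {κ : Type*} {s : Finset κ} {φ : κ → ConvexBody V → ℝ}
    (h : ∀ k ∈ s, IsValuation (φ k)) : IsValuation fun B => ∑ k ∈ s, φ k B := by
  intro A B C D hC hD
  simp only
  rw [← Finset.sum_add_distrib, ← Finset.sum_sub_distrib]
  exact Finset.sum_congr rfl fun k hk => h k hk A B C D hC hD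

section MapBody

variable [FiniteDimensional ℝ V]

theorem coe_mapBody (T : V →ₗ[ℝ] E) (B : ConvexBody V) : (mapBody T B : Set E) = T '' B := rfl

theorem mem_mapBody_add {T : V →ₗ[ℝ] E} {B : ConvexBody V} {C : ConvexBody E} {x : E} :
    x ∈ ((mapBody T B + C : ConvexBody E) : Set E) ↔
      ∃ b ∈ (B : Set V), ∃ c ∈ (C : Set E), T b + c = x := by
  rw [ConvexBody.coe_add, coe_mapBody, Set.mem_add]
  simp only [Set.exists_mem_image]

theorem continuous_mapBody_add (T : V →ₗ[ℝ] E) (C : ConvexBody E) :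
    Continuous fun B : ConvexBody V => mapBody T B + C := by
  set L := LinearMap.toContinuousLinearMap T with hL
  have key : ∀ B B' : ConvexBody V, ∀ x ∈ ((mapBody T B + C : ConvexBody E) : Set E),
      ∃ y ∈ ((mapBody T B' + C : ConvexBody E) : Set E), dist x y ≤ ‖L‖ * dist B B' := by
    intro B B' x hx
    obtain ⟨b, hb, c, hc, rfl⟩ := mem_mapBody_add.1 hx
    obtain ⟨b', hb', hd⟩ := exists_dist_le_of_mem_body B B' hb
    refine ⟨T b' + c, mem_mapBody_add.2 ⟨b', hb', c, hc, rfl⟩, ?_⟩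
    rw [dist_add_right, dist_eq_norm, ← map_sub]
    rw [dist_eq_norm] at hd
    exact (L.le_opNorm (b - b')).trans (mul_le_mul_of_nonneg_left hd (norm_nonneg _))
  refine (LipschitzWith.of_dist_le_mul (K := ‖L‖₊) fun B B' => ?_).continuous
  refine Metric.hausdorffDist_le_of_mem_dist (by positivity) (key B B') fun x hx => ?_
  rw [dist_comm B B']
  exact key B' B x hx

/-- For a convex body the `m`-fold Minkowski sum is the dilate by `m`. Repeated entries in a mixed
volume thus merge into a single linear image. -/
theorem nsmul_mapBody (m : ℕ) (T : V →ₗ[ℝ] E) (B : ConvexBody V) :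
    m • mapBody T B = mapBody ((m : ℝ) • T) B := by
  rw [← Nat.cast_smul_eq_nsmul NNReal]
  ext x
  rw [ConvexBody.coe_smul', Set.mem_smul_set]
  simp only [coe_mapBody, exists_exists_and_eq_and, Set.mem_image, NNReal.smul_def,
    NNReal.coe_natCast, LinearMap.smul_apply]

theorem mapBody_smul (T : V →ₗ[ℝ] E) (t : ℝ) (B : ConvexBody V) :
    mapBody T (t • B) = t • mapBody T B := by
  ext x
  rw [ConvexBody.coe_smul, coe_mapBody, coe_mapBody, ConvexBody.coe_smul, Set.mem_image,
    Set.mem_smul_set]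
  simp only [Set.mem_smul_set, Set.mem_image, exists_exists_and_eq_and, map_smul]

variable [MeasurableSpace E] [BorelSpace E]

theorem isValuation_volume_mapBody_add (μ : Measure E) [μ.IsAddHaarMeasure]
    (T : V →ₗ[ℝ] E) (C : ConvexBody E) :
    IsValuation fun B : ConvexBody V =>
      μ.real ((mapBody T B + C : ConvexBody E) : Set E) := by
  intro A B U D hU hD
  have h1 : ((mapBody T U + C : ConvexBody E) : Set E) =
      ((mapBody T A + C : ConvexBody E) : Set E) ∪ (mapBody T B + C : ConvexBody E) := by
    simp only [ConvexBody.coe_add, coe_mapBody, hU, Set.image_union, Set.union_add]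
  have h2 : ((mapBody T D + C : ConvexBody E) : Set E) =
      ((mapBody T A + C : ConvexBody E) : Set E) ∩ (mapBody T B + C : ConvexBody E) := by
    ext x
    rw [Set.mem_inter_iff]
    simp only [mem_mapBody_add, hD]
    constructor
    · rintro ⟨z, ⟨hzA, hzB⟩, c, hc, rfl⟩
      exact ⟨⟨z, hzA, c, hc, rfl⟩, ⟨z, hzB, c, hc, rfl⟩⟩
    -- The segment from `a` to `b` meets the intersection of `A` and `B`, as their union is convex.
    -- The same convex combination of `c` and `c'` then represents the given point.
    · rintro ⟨⟨a, ha, c, hc, rfl⟩, ⟨b, hb, c', hc', h⟩⟩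
      obtain ⟨z, ⟨s, t, hs, ht, hst, rfl⟩, hz⟩ :=
        exists_segment_mem_inter A.isClosed B.isClosed (hU ▸ U.convex) ha hb
      refine ⟨_, hz, s • c + t • c', C.convex hc hc' hs ht hst, ?_⟩
      calc T (s • a + t • b) + (s • c + t • c') = s • (T a + c) + t • (T b + c') := by
            simp only [map_add, map_smul]; module
        _ = T a + c := by rw [h, ← add_smul, hst, one_smul]
  have h3 := measureReal_union_add_inter (μ := μ)
    (s := ((mapBody T A + C : ConvexBody E) : Set E))
    (ConvexBody.isClosed (mapBody T B + C)).measurableSet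
    (ConvexBody.isCompact _).measure_lt_top.ne (ConvexBody.isCompact _).measure_lt_top.ne
  simp only [h1, h2]
  linarith

end MapBody

variable [FiniteDimensional ℝ E] [MeasurableSpace E] [BorelSpace E]

/-- The volume is a continuous function of a convex body. -/
theorem continuous_volume_body (μ : Measure E) [μ.IsAddHaarMeasure] :
    Continuous fun K : ConvexBody E => μ.real (K : Set E) := by
  rw [continuous_iff_continuousAt]
  intro K₀
  have : ProperSpace E := FiniteDimensional.proper ℝ E
  have hB : IsCompact (Metric.cthickening 1 (K₀ : Set E)) := K₀.isCompact.cthickening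
  -- Dominated convergence of indicators: nearby bodies lie in the compact 1-thickening, and
  -- membership of a point is locally constant in the body off the null frontier of `K₀`.
  have h := tendsto_measure_of_ae_tendsto_indicator (𝓝 K₀) (μ := μ)
    (As := fun K : ConvexBody E => (K : Set E)) (A := (K₀ : Set E))
    K₀.isClosed.measurableSet (fun K => K.isClosed.measurableSet) hB.isClosed.measurableSet
    hB.measure_lt_top.ne ?_ ?_
  · exact (ENNReal.tendsto_toReal K₀.isCompact.measure_lt_top.ne).comp h
  · filter_upwards [Metric.ball_mem_nhds K₀ one_pos] with K hK x hx
    obtain ⟨y, hy, hd⟩ := exists_dist_le_of_mem_body K K₀ hx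
    exact Metric.mem_cthickening_of_dist_le x y 1 _ hy (hd.trans (Metric.mem_ball.1 hK).le)
  · have hfr : ∀ᵐ x ∂μ, x ∉ frontier (K₀ : Set E) :=
      measure_eq_zero_iff_ae_notMem.1 (K₀.convex.addHaar_frontier μ)
    filter_upwards [hfr] with x hx
    exact eventually_mem_body_iff hx

variable [FiniteDimensional ℝ V]

theorem isTranslationInvariant_volume_mapBody_add (μ : Measure E) [μ.IsAddHaarMeasure]
    (T : V →ₗ[ℝ] E) (C : ConvexBody E) :
    IsTranslationInvariant fun B : ConvexBody V =>
      μ.real ((mapBody T B + C : ConvexBody E) : Set E) := by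
  intro x A
  have h : ((mapBody T (translate x A) + C : ConvexBody E) : Set E) =
      T x +ᵥ ((mapBody T A + C : ConvexBody E) : Set E) := by
    ext z
    rw [mem_mapBody_add, Set.mem_vadd_set]
    constructor
    · rintro ⟨_, ⟨a, ha, rfl⟩, c, hc, rfl⟩
      exact ⟨_, mem_mapBody_add.2 ⟨a, ha, c, hc, rfl⟩, by simp [add_assoc]⟩
    · rintro ⟨_, hy, rfl⟩
      obtain ⟨a, ha, c, hc, rfl⟩ := mem_mapBody_add.1 hy
      exact ⟨_, ⟨a, ha, rfl⟩, c, hc, by simp [add_assoc]⟩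
  simp only [h, measureReal_def, measure_vadd]

/-- Dependence of a mixed volume on a body occupying several entries. -/
theorem mixedVolume_mapBody_regularity {ι : Type*} [Fintype ι] (μ : Measure E)
    [μ.IsAddHaarMeasure] (T : V →ₗ[ℝ] E) (p : ι → Prop) [DecidablePred p]
    (K : ι → ConvexBody E) :
    IsValuation (fun B : ConvexBody V =>
      mixedVolume μ fun i => if p i then mapBody T B else K i) ∧
    IsTranslationInvariant (fun B : ConvexBody V =>
      mixedVolume μ fun i => if p i then mapBody T B else K i) ∧
    Continuous fun B : ConvexBody V =>
      mixedVolume μ fun i => if p i then mapBody T B else K i := by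
  have h : ∀ (I : Finset ι) (B : ConvexBody V),
      ∑ i ∈ I, (if p i then mapBody T B else K i) =
        mapBody (((I.filter p).card : ℝ) • T) B + ∑ i ∈ I with ¬ p i, K i := by
    intro I B
    rw [Finset.sum_ite, Finset.sum_const, nsmul_mapBody]
  simp only [mixedVolume, h]
  refine ⟨IsValuation.const_mul (IsValuation.sum fun I _ => IsValuation.const_mul
    (isValuation_volume_mapBody_add μ (((I.filter p).card : ℝ) • T) (∑ i ∈ I with ¬ p i, K i))
      ((-1) ^ (Fintype.card ι - I.card))) _, fun x A => ?_, ?_⟩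
  · dsimp only
    congr 1
    refine Finset.sum_congr rfl fun I _ => ?_
    congr 1
    exact isTranslationInvariant_volume_mapBody_add μ _ _ x A
  · exact continuous_const.mul (continuous_finsetSum _ fun I _ =>
      continuous_const.mul ((continuous_volume_body μ).comp (continuous_mapBody_add _ _)))

end VolumeOfBodies

/-! ### Mixed volumes under linear isomorphisms. -/

section Transport

variable {U U' : Type*} [AddCommGroup U] [Module ℝ U] [TopologicalSpace U] [ContinuousAdd U]
  [MeasurableSpace U] [AddCommGroup U'] [Module ℝ U'] [TopologicalSpace U'] [ContinuousAdd U']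
  [MeasurableSpace U']

/-- Behaviour of mixed volumes under linear isomorphisms and relabelling of the bodies. -/
theorem mixedVolume_eq_mul_of_image {ι ι' : Type*} [Fintype ι] [Fintype ι'] {ν : Measure U}
    {ν' : Measure U'} (e : U →ₗ[ℝ] U') (c : ℝ) (σ : ι ≃ ι')
    (hν : ∀ K : ConvexBody U, ν.real (K : Set U) = c * ν'.real (e '' K))
    {K : ι → ConvexBody U} {K' : ι' → ConvexBody U'}
    (hK : ∀ i, (K' (σ i) : Set U') = e '' K i) :
    mixedVolume ν K = c * mixedVolume ν' K' := by
  rw [mixedVolume, mixedVolume, Fintype.card_congr σ, mul_left_comm]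
  refine congrArg _ ((Fintype.sum_equiv σ.finsetCongr _ _ fun I => ?_).trans (Finset.mul_sum _ _ _).symm)
  have h : ((∑ i ∈ σ.finsetCongr I, K' i : ConvexBody U') : Set U') =
      e '' ((∑ i ∈ I, K i : ConvexBody U) : Set U) := by
    rw [coe_sum_body, coe_sum_body, Set.image_finsetSum, Equiv.finsetCongr_apply, Finset.sum_map]
    exact Finset.sum_congr rfl fun i _ => hK i
  rw [hν, h, Equiv.finsetCongr_apply, Finset.card_map]
  ring

end Transport

/-! ### Invariance of the measure on the cokernel. -/

section CokerMeasure

variable {W : Type*} [NormedAddCommGroup W] [NormedSpace ℝ W] [FiniteDimensional ℝ W]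
  [MeasurableSpace W] [BorelSpace W] {l : ℕ} [NeZero l]

instance isAddHaarMeasure_cokerMeasure (μ : Measure W) [μ.IsAddHaarMeasure] :
    (cokerMeasure μ l).IsAddHaarMeasure := by
  unfold cokerMeasure
  infer_instance

/-- An automorphism of the exact sequence that preserves the measures on the first two terms
preserves the measure on the third. -/
theorem map_cokerMeasure (μ : Measure W) [μ.IsAddHaarMeasure] (T₁ : W ≃L[ℝ] W)
    (T₂ : (Fin l → W) ≃L[ℝ] (Fin l → W)) (T₃ : Coker W l ≃L[ℝ] Coker W l)
    (h₁₂ : ∀ a, T₂ (diag W l a) = diag W l (T₁ a))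
    (h₂₃ : ∀ b, T₃ ((LinearMap.range (diag W l)).mkQ b) = (LinearMap.range (diag W l)).mkQ (T₂ b))
    (hT₁ : MeasurePreserving T₁ μ μ)
    (hT₂ : MeasurePreserving T₂ (Measure.pi fun _ : Fin l => μ) (Measure.pi fun _ : Fin l => μ)) :
    (cokerMeasure μ l).map T₃ = cokerMeasure μ l := by
  have : ProperSpace (Fin l → W) := FiniteDimensional.proper ℝ _
  have : ProperSpace (Coker W l) := FiniteDimensional.proper ℝ (Coker W l)
  have : ProperSpace W := FiniteDimensional.proper ℝ W
  have hHaar : ((cokerMeasure μ l).map T₃).IsAddHaarMeasure := T₃.isAddHaarMeasure_map _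
  -- It suffices that the pushed-forward measure satisfies the defining integral formula. The
  -- formula for `φ` follows from the known one for `φ ∘ T₂`, by a change of variables by `T₁` in
  -- the inner integral and `T₃` in the outer one.
  refine quotientMeasure_unique isSES_diag μ (Measure.pi fun _ : Fin l => μ) _ ?_
  refine Measure.ext_of_integral_eq_on_compactlySupported fun φ => ?_
  set φ' := φ.comp T₂.toHomeomorph.toCocompactMap with hφ'
  have hφ'_apply : ∀ b, φ' b = φ (T₂ b) := fun _ => rfl
  have h1 : ∫ b, φ b ∂(Measure.pi fun _ : Fin l => μ) =
      ∫ b, φ' b ∂(Measure.pi fun _ : Fin l => μ) :=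
    (hT₂.integral_comp T₂.toHomeomorph.measurableEmbedding φ).symm
  have h2 : ∫ b, φ' b ∂(Measure.pi fun _ : Fin l => μ) =
      ∫ c, isSES_diag.pushforward μ φ' c ∂(cokerMeasure μ l) := by
    conv_lhs => rw [← inducedMeasure_quotientMeasure (isSES_diag (W := W) (l := l)) μ
      (Measure.pi fun _ : Fin l => μ)]
    rw [isSES_diag.integral_inducedMeasure, isSES_diag.integrate_apply]
    rfl
  rw [isSES_diag.integral_inducedMeasure, isSES_diag.integrate_apply, h1, h2]
  refine (integral_map (μ := cokerMeasure μ l) (f := fun c => isSES_diag.pushforward μ φ c)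
    T₃.continuous.aemeasurable
    (isSES_diag.pushforward μ φ).continuous.aestronglyMeasurable).trans
    (integral_congr_ae (Filter.Eventually.of_forall fun c => ?_))
  dsimp only
  obtain ⟨b, rfl⟩ := Submodule.mkQ_surjective _ c
  rw [h₂₃]
  refine (isSES_diag.pushforward_apply_apply μ φ (T₂ b)).trans
    (Eq.trans ?_ (isSES_diag.pushforward_apply_apply μ φ' b).symm)
  simp only [TopologicalAddGroup.IsSES.pullback_def, hφ'_apply]
  have h3 := hT₁.integral_comp T₁.toHomeomorph.measurableEmbedding
    (fun a => φ (T₂ b + (diag W l).toAddMonoidHom a))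
  refine h3.symm.trans (integral_congr_ae (Filter.Eventually.of_forall fun a => ?_))
  show φ (T₂ b + diag W l (T₁ a)) = φ (T₂ (b + diag W l a))
  rw [map_add T₂, h₁₂]

/-- Since `T₂` maps the diagonal onto itself, it descends to the cokernel and preserves the measure
there. The condition `hK` is phrased on representatives, so that applications need not mention the
induced map. -/
theorem mixedVolume_cokerMeasure_congr (μ : Measure W) [μ.IsAddHaarMeasure] (T₁ : W ≃L[ℝ] W)
    (T₂ : (Fin l → W) ≃L[ℝ] (Fin l → W))
    (h₁₂ : ∀ a, T₂ (diag W l a) = diag W l (T₁ a))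
    (hT₁ : MeasurePreserving T₁ μ μ)
    (hT₂ : MeasurePreserving T₂ (Measure.pi fun _ : Fin l => μ) (Measure.pi fun _ : Fin l => μ))
    {ι ι' : Type*} [Fintype ι] [Fintype ι'] (σ : ι ≃ ι') {K : ι → ConvexBody (Coker W l)}
    {K' : ι' → ConvexBody (Coker W l)}
    (hK : ∀ i b, (LinearMap.range (diag W l)).mkQ (T₂ b) ∈ (K' (σ i) : Set (Coker W l)) ↔
      (LinearMap.range (diag W l)).mkQ b ∈ (K i : Set (Coker W l))) :
    mixedVolume (cokerMeasure μ l) K = mixedVolume (cokerMeasure μ l) K' := by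
  have hmap : (LinearMap.range (diag W l)).map T₂.toLinearEquiv.toLinearMap =
      LinearMap.range (diag W l) := by
    ext w
    simp only [Submodule.mem_map, LinearMap.mem_range]
    constructor
    · rintro ⟨_, ⟨a, rfl⟩, rfl⟩
      exact ⟨T₁ a, (h₁₂ a).symm⟩
    · rintro ⟨a, rfl⟩
      exact ⟨_, ⟨T₁.symm a, rfl⟩, (h₁₂ _).trans (by rw [T₁.apply_symm_apply])⟩
  set T₃ : Coker W l ≃ₗ[ℝ] Coker W l :=
    Submodule.Quotient.equiv _ _ T₂.toLinearEquiv hmap with hT₃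
  have hT₃m : (cokerMeasure μ l).map T₃.toContinuousLinearEquiv = cokerMeasure μ l :=
    map_cokerMeasure μ T₁ T₂ T₃.toContinuousLinearEquiv h₁₂ (fun b => rfl) hT₁ hT₂
  rw [mixedVolume_eq_mul_of_image (ν := cokerMeasure μ l) (ν' := cokerMeasure μ l)
    T₃.toLinearMap 1 σ (fun K => ?_) (fun i => ?_), one_mul]
  · rw [one_mul]
    conv_rhs => rw [← hT₃m]
    have : MeasurableSet (T₃.toLinearMap '' (K : Set (Coker W l))) :=
      (K.isCompact.image T₃.toContinuousLinearEquiv.continuous).isClosed.measurableSet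
    rw [measureReal_def, measureReal_def,
      Measure.map_apply T₃.toContinuousLinearEquiv.continuous.measurable this]
    congr 2
    exact (Set.preimage_image_eq _ T₃.injective).symm
  · ext c
    obtain ⟨b, rfl⟩ := Submodule.mkQ_surjective _ c
    obtain ⟨b, rfl⟩ := T₂.surjective b
    rw [hK]
    have h : T₃.toLinearMap ((LinearMap.range (diag W l)).mkQ b) =
        (LinearMap.range (diag W l)).mkQ (T₂ b) := rfl
    rw [← h]
    exact (T₃.injective.mem_set_image).symm

end CokerMeasure

/-! ### Symmetry and invariance under the special linear group. -/

section HigherMixedVolume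

variable {W : Type*} [NormedAddCommGroup W] [NormedSpace ℝ W] [FiniteDimensional ℝ W]
  [MeasurableSpace W] [BorelSpace W] {l : ℕ} [NeZero l]

/-- Permuting the factors of `W^l` preserves the product measure, fixes the diagonal pointwise, and
moves the `i`-th summand to the `ρ i`-th. -/
theorem higherMixedVolume_perm (μ : Measure W) [μ.IsAddHaarMeasure] (k : Fin l → ℕ)
    (ρ : Equiv.Perm (Fin l)) (A : ∀ i, Fin (finrank ℝ W - k i) → ConvexBody W) :
    higherMixedVolume μ (fun i => k (ρ i)) (fun i => A (ρ i)) = higherMixedVolume μ k A := by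
  set T₂ : (Fin l → W) ≃L[ℝ] (Fin l → W) :=
    (LinearEquiv.funCongrLeft ℝ W ρ.symm).toContinuousLinearEquiv with hT₂
  have hT : ∀ (b : Fin l → W) i, T₂ b i = b (ρ.symm i) := fun _ _ => rfl
  refine mixedVolume_cokerMeasure_congr μ (ContinuousLinearEquiv.refl ℝ W) T₂ (fun a => rfl)
    (MeasurePreserving.id μ) ?_
    (Equiv.sigmaCongrLeft (β := fun i => Fin (finrank ℝ W - k i)) ρ) ?_
  · have h := measurePreserving_piCongrLeft (fun _ : Fin l => μ) ρ
    convert! h using 1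
    funext b i
    rw [hT]
    obtain ⟨j, rfl⟩ := ρ.surjective i
    rw [Equiv.symm_apply_apply]
    exact (Equiv.piCongrLeft_apply_apply (fun _ : Fin l => W) ρ b j).symm
  · rintro ⟨i, j⟩ b
    show _ ∈ toCoker W l (ρ i) '' (A (ρ i) j) ↔ _ ∈ toCoker W l i '' (A (ρ i) j)
    simp only [Set.mem_image]
    refine exists_congr fun w => and_congr_right fun _ => ?_
    have h : T₂ (Pi.single i w) = Pi.single (ρ i) w := by
      funext m
      rw [hT, Pi.single_apply, Pi.single_apply]
      simp only [Equiv.symm_apply_eq]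
    have h' : toCoker W l (ρ i) w = (LinearMap.range (diag W l)).mkQ (T₂ (Pi.single i w)) := by
      rw [h]; rfl
    have h'' : toCoker W l i w = (LinearMap.range (diag W l)).mkQ (Pi.single i w) := rfl
    rw [h', h'', Submodule.mkQ_apply, Submodule.mkQ_apply, Submodule.mkQ_apply,
      Submodule.mkQ_apply, Submodule.Quotient.eq, Submodule.Quotient.eq, ← map_sub]
    constructor
    · rintro ⟨a, ha⟩
      exact ⟨a, T₂.injective ha⟩
    · rintro ⟨a, ha⟩
      exact ⟨a, by rw [← ha]; rfl⟩

/-- Applying `g` in every factor of `W^l` restricts to `g` on the diagonal, and determinant one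
makes both maps measure preserving. -/
theorem higherMixedVolume_specialLinear (μ : Measure W) [μ.IsAddHaarMeasure] (k : Fin l → ℕ)
    (g : SpecialLinearGroup ℝ W) (A : ∀ i, Fin (finrank ℝ W - k i) → ConvexBody W) :
    higherMixedVolume μ k (fun i j => mapBody (g : W ≃ₗ[ℝ] W).toLinearMap (A i j)) =
      higherMixedVolume μ k A := by
  set T₁ : W ≃L[ℝ] W := (g : W ≃ₗ[ℝ] W).toContinuousLinearEquiv with hT₁
  set T₂ : (Fin l → W) ≃L[ℝ] (Fin l → W) := ContinuousLinearEquiv.piCongrRight fun _ => T₁ with hT₂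
  have hT : ∀ (b : Fin l → W) i, T₂ b i = T₁ (b i) := fun _ _ => rfl
  have hm : MeasurePreserving T₁ μ μ := by
    refine ⟨T₁.continuous.measurable, ?_⟩
    have hd := SpecialLinearGroup.det_eq_one g
    have h := Measure.map_linearMap_addHaar_eq_smul_addHaar μ
      (f := ((g : W ≃ₗ[ℝ] W) : W →ₗ[ℝ] W)) (by rw [hd]; exact one_ne_zero)
    rw [hd, inv_one, abs_one, ENNReal.ofReal_one, one_smul] at h
    exact h
  refine (mixedVolume_cokerMeasure_congr μ T₁ T₂ (fun a => rfl) hm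
    (measurePreserving_pi _ _ fun _ => hm) (Equiv.refl _) ?_).symm
  rintro ⟨i, j⟩ b
  show _ ∈ toCoker W l i '' (T₁ '' (A i j)) ↔ _ ∈ toCoker W l i '' (A i j)
  rw [Set.image_image]
  simp only [Set.mem_image]
  refine exists_congr fun w => and_congr_right fun _ => ?_
  have h : T₂ (Pi.single i w) = Pi.single i (T₁ w) := by
    funext m
    rw [hT, Pi.single_apply, Pi.single_apply]
    split_ifs <;> simp
  have h' : toCoker W l i (T₁ w) = (LinearMap.range (diag W l)).mkQ (T₂ (Pi.single i w)) := by
    rw [h]; rfl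
  have h'' : toCoker W l i w = (LinearMap.range (diag W l)).mkQ (Pi.single i w) := rfl
  rw [h', h'', Submodule.mkQ_apply, Submodule.mkQ_apply, Submodule.mkQ_apply,
    Submodule.mkQ_apply, Submodule.Quotient.eq, Submodule.Quotient.eq, ← map_sub]
  constructor
  · rintro ⟨a, ha⟩
    refine ⟨T₁.symm a, T₂.injective ?_⟩
    rw [← ha]
    funext m
    exact T₁.apply_symm_apply a
  · rintro ⟨a, ha⟩
    exact ⟨T₁ a, by rw [← ha]; rfl⟩

end HigherMixedVolume

/-! ### Linear algebra of the cokernel and the remaining properties. -/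

section Coordinates

variable {W : Type*} [NormedAddCommGroup W] [NormedSpace ℝ W] {l : ℕ}

theorem sum_toCoker (w : Fin l → W) :
    ∑ i, toCoker W l i (w i) = (LinearMap.range (diag W l)).mkQ w := by
  simp only [toCoker, LinearMap.comp_apply]
  rw [← map_sum]
  congr 1
  exact Finset.univ_sum_single w

/-- Both numbers are `n(l-1)`. Hence coordinates on the cokernel can be indexed by the bodies
themselves, as the mixed discriminant formula requires. -/
theorem finrank_coker [FiniteDimensional ℝ W] [NeZero l] {k : Fin l → ℕ} (hn : ∑ i, k i = finrank ℝ W) :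
    finrank ℝ (Coker W l) = Fintype.card ((i : Fin l) × Fin (finrank ℝ W - k i)) := by
  have h1 := Submodule.finrank_quotient_add_finrank (LinearMap.range (diag W l))
  have hinj : Function.Injective (diag W l) := fun x y h => congrFun h 0
  rw [LinearMap.finrank_range_of_inj hinj, Module.finrank_pi_fintype] at h1
  have h2 : ∑ i, (finrank ℝ W - k i) + ∑ i, k i = ∑ _i : Fin l, finrank ℝ W := by
    rw [← Finset.sum_add_distrib]
    refine Finset.sum_congr rfl fun i _ => Nat.sub_add_cancel ?_
    rw [← hn]
    exact Finset.single_le_sum (f := k) (fun _ _ => Nat.zero_le _) (Finset.mem_univ i)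
  rw [Fintype.card_sigma]
  simp only [Fintype.card_fin]
  lia

/-- Vectors `f_i (d_{ij})` are independent in the cokernel iff, for each `i`, the `d_{ij}` are
independent and the subspaces they span have trivial intersection. -/
theorem linearIndependent_toCoker_iff [NeZero l] {m : Fin l → ℕ} (d : ∀ i, Fin (m i) → W) :
    (LinearIndependent ℝ fun p : (i : Fin l) × Fin (m i) => toCoker W l p.1 (d p.1 p.2)) ↔
      (∀ i, finrank ℝ (Submodule.span ℝ (Set.range (d i))) = m i) ∧
        ⨅ i, Submodule.span ℝ (Set.range (d i)) = ⊥ := by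
  have hfr : ∀ i, finrank ℝ (Submodule.span ℝ (Set.range (d i))) = m i ↔
      LinearIndependent ℝ (d i) := by
    intro i
    rw [linearIndependent_iff_card_eq_finrank_span, Fintype.card_fin, eq_comm]
    rfl
  simp_rw [hfr]
  -- A combination vanishes in the cokernel exactly when the tuple of its partial sums over `j` is
  -- diagonal, that is, when all of them equal one vector, which then lies in every span.
  have hsum : ∀ c : (i : Fin l) × Fin (m i) → ℝ,
      ∑ p, c p • toCoker W l p.1 (d p.1 p.2) =
        (LinearMap.range (diag W l)).mkQ fun i => ∑ j, c ⟨i, j⟩ • d i j := by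
    intro c
    rw [← sum_toCoker, Fintype.sum_sigma]
    simp only [map_sum, map_smul]
  constructor
  · intro h
    refine ⟨fun i => ?_, ?_⟩
    · have h1 : LinearIndependent ℝ fun j => toCoker W l i (d i j) :=
        h.comp (fun j => ⟨i, j⟩) fun a b hab => by simpa using hab
      exact LinearIndependent.of_comp (toCoker W l i) h1
    · rw [eq_bot_iff]
      intro w hw
      rw [Submodule.mem_iInf] at hw
      have h1 := fun i => (Submodule.mem_span_range_iff_exists_fun ℝ).1 (hw i)
      choose c hc using h1
      have h2 := hsum fun p => c p.1 p.2
      simp only [hc] at h2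
      have h3 : (LinearMap.range (diag W l)).mkQ (fun _ => w) = 0 := by
        rw [Submodule.mkQ_apply, Submodule.Quotient.mk_eq_zero]
        exact ⟨w, rfl⟩
      rw [h3] at h2
      have h4 := Fintype.linearIndependent_iff.1 h _ h2
      rw [Submodule.mem_bot, ← hc 0]
      exact Finset.sum_eq_zero fun j _ => by rw [h4 ⟨0, j⟩, zero_smul]
  · rintro ⟨h1, h2⟩
    rw [Fintype.linearIndependent_iff]
    intro c hc
    rw [hsum, Submodule.mkQ_apply, Submodule.Quotient.mk_eq_zero] at hc
    obtain ⟨w, hw⟩ := hc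
    have hwi : ∀ i, ∑ j, c ⟨i, j⟩ • d i j = w := fun i => (congrFun hw i).symm
    have hw0 : w = 0 := by
      rw [← Submodule.mem_bot ℝ, ← h2, Submodule.mem_iInf]
      exact fun i => (Submodule.mem_span_range_iff_exists_fun ℝ).2 ⟨fun j => c ⟨i, j⟩, hwi i⟩
    rintro ⟨i, j⟩
    exact Fintype.linearIndependent_iff.1 (h1 i) (fun j => c ⟨i, j⟩) ((hwi i).trans hw0) j

variable [FiniteDimensional ℝ W] [MeasurableSpace W] [BorelSpace W] [NeZero l]

/-- Higher mixed volumes as mixed volumes in coordinates of the cokernel. -/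
theorem exists_higherMixedVolume_eq (μ : Measure W) [μ.IsAddHaarMeasure] {k : Fin l → ℕ}
    (hn : ∑ i, k i = finrank ℝ W) :
    ∃ (e : Coker W l ≃ₗ[ℝ] ((i : Fin l) × Fin (finrank ℝ W - k i) → ℝ)) (c : ℝ), 0 < c ∧
      ∀ A : ∀ i, Fin (finrank ℝ W - k i) → ConvexBody W, higherMixedVolume μ k A =
        c * mixedVolume volume fun p : (i : Fin l) × Fin (finrank ℝ W - k i) =>
          mapBody (e.toLinearMap ∘ₗ toCoker W l p.1) (A p.1 p.2) := by
  set ι := (i : Fin l) × Fin (finrank ℝ W - k i) with hι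
  have hfin : finrank ℝ (Coker W l) = finrank ℝ (ι → ℝ) := by
    rw [finrank_coker hn, Module.finrank_fintype_fun_eq_card]
  let e : Coker W l ≃ₗ[ℝ] (ι → ℝ) := LinearEquiv.ofFinrankEq _ _ hfin
  let E : Coker W l ≃L[ℝ] (ι → ℝ) := e.toContinuousLinearEquiv
  have hHaar : ((cokerMeasure μ l).map E).IsAddHaarMeasure := E.isAddHaarMeasure_map _
  have hs := Measure.isAddLeftInvariant_eq_smul ((cokerMeasure μ l).map E) volume
  set s := Measure.addHaarScalarFactor ((cokerMeasure μ l).map E) volume with hs_def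
  -- The isomorphism `e` is arbitrary, so the measures agree only up to this positive factor; signs
  -- and inequalities are unaffected.
  have hspos : 0 < s := Measure.addHaarScalarFactor_pos_of_isAddHaarMeasure _ _
  refine ⟨e, s, hspos, fun A => ?_⟩
  refine mixedVolume_eq_mul_of_image e.toLinearMap (s : ℝ) (Equiv.refl ι) (fun K => ?_)
    fun p => ?_
  · have hm : MeasurableSet (E '' (K : Set (Coker W l))) :=
      (K.isCompact.image E.continuous).isClosed.measurableSet
    have h1 : (cokerMeasure μ l) (K : Set (Coker W l)) =
        ((cokerMeasure μ l).map E) (E '' (K : Set (Coker W l))) := by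
      rw [Measure.map_apply E.continuous.measurable hm, Set.preimage_image_eq _ E.injective]
    rw [measureReal_def, h1, hs, Measure.smul_apply, ENNReal.smul_def, smul_eq_mul,
      ENNReal.toReal_mul]
    rfl
  · show (e.toLinearMap ∘ₗ toCoker W l p.1) '' (A p.1 p.2) =
      e.toLinearMap '' (toCoker W l p.1 '' (A p.1 p.2))
    rw [Set.image_image]
    rfl

theorem higherMixedVolume_nonneg (μ : Measure W) [μ.IsAddHaarMeasure] {k : Fin l → ℕ}
    (hn : ∑ i, k i = finrank ℝ W) (A : ∀ i, Fin (finrank ℝ W - k i) → ConvexBody W) :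
    0 ≤ higherMixedVolume μ k A := by
  obtain ⟨e, c, hc, h⟩ := exists_higherMixedVolume_eq μ hn
  rw [h]
  exact mul_nonneg hc.le (mixedVolume_nonneg _)

theorem higherMixedVolume_mono (μ : Measure W) [μ.IsAddHaarMeasure] {k : Fin l → ℕ}
    (hn : ∑ i, k i = finrank ℝ W) {A A' : ∀ i, Fin (finrank ℝ W - k i) → ConvexBody W}
    (hA : ∀ i j, (A i j : Set W) ⊆ A' i j) :
    higherMixedVolume μ k A ≤ higherMixedVolume μ k A' := by
  obtain ⟨e, c, hc, h⟩ := exists_higherMixedVolume_eq μ hn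
  rw [h, h]
  exact mul_le_mul_of_nonneg_left
    (mixedVolume_mono fun p => Set.image_mono (hA p.1 p.2)) hc.le

theorem higherMixedVolume_pos_iff (μ : Measure W) [μ.IsAddHaarMeasure] {k : Fin l → ℕ}
    (hn : ∑ i, k i = finrank ℝ W) (A : ∀ i, Fin (finrank ℝ W - k i) → ConvexBody W) :
    0 < higherMixedVolume μ k A ↔
      ∃ x y : ∀ i, Fin (finrank ℝ W - k i) → W,
        (∀ i j, segment ℝ (x i j) (y i j) ⊆ (A i j : Set W)) ∧
        (∀ i, finrank ℝ (Submodule.span ℝ (Set.range fun j => y i j - x i j)) =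
          finrank ℝ W - k i) ∧
        ⨅ i, Submodule.span ℝ (Set.range fun j => y i j - x i j) = ⊥ := by
  obtain ⟨e, c, hc, h⟩ := exists_higherMixedVolume_eq μ hn
  rw [h, mul_pos_iff_of_pos_left hc, mixedVolume_pos_iff]
  have key : ∀ x y : ∀ i, Fin (finrank ℝ W - k i) → W,
      (LinearIndependent ℝ fun p : (i : Fin l) × Fin (finrank ℝ W - k i) =>
        (e.toLinearMap ∘ₗ toCoker W l p.1) (y p.1 p.2) -
          (e.toLinearMap ∘ₗ toCoker W l p.1) (x p.1 p.2)) ↔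
      (∀ i, finrank ℝ (Submodule.span ℝ (Set.range fun j => y i j - x i j)) =
          finrank ℝ W - k i) ∧
        ⨅ i, Submodule.span ℝ (Set.range fun j => y i j - x i j) = ⊥ := by
    intro x y
    rw [← linearIndependent_toCoker_iff fun i j => y i j - x i j,
      ← LinearMap.linearIndependent_iff e.toLinearMap (LinearEquiv.ker e)]
    simp only [← map_sub]
    rfl
  constructor
  · rintro ⟨x, y, hx, hy, hxy⟩
    -- End points in the images are lifted to end points in the bodies of `W`.
    choose x' hx' hx'' using hx
    choose y' hy' hy'' using hy
    refine ⟨fun i j => x' ⟨i, j⟩, fun i j => y' ⟨i, j⟩, fun i j =>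
      (A i j).convex.segment_subset (hx' ⟨i, j⟩) (hy' ⟨i, j⟩), (key _ _).1 ?_⟩
    simp only [← hx'', ← hy''] at hxy
    exact hxy
  · rintro ⟨x, y, hA, hxy⟩
    exact ⟨_, _, fun p => ⟨_, hA p.1 p.2 (left_mem_segment ℝ _ _), rfl⟩,
      fun p => ⟨_, hA p.1 p.2 (right_mem_segment ℝ _ _), rfl⟩, (key x y).2 hxy⟩

theorem higherMixedVolume_update_regularity (μ : Measure W) [μ.IsAddHaarMeasure] {k : Fin l → ℕ}
    (hn : ∑ i, k i = finrank ℝ W) (A : ∀ i, Fin (finrank ℝ W - k i) → ConvexBody W) (i : Fin l)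
    {φ : ConvexBody W → ℝ}
    (hφ : ∀ B, φ B = higherMixedVolume μ k (Function.update A i fun _ => B)) :
    IsValuation φ ∧ IsHomogeneous (finrank ℝ W - k i) φ ∧ IsTranslationInvariant φ ∧
      Continuous φ := by
  obtain ⟨e, c, hc, h⟩ := exists_higherMixedVolume_eq μ hn
  set T := fun i => e.toLinearMap ∘ₗ toCoker W l i with hT
  have hupd : ∀ B, (fun p : (i : Fin l) × Fin (finrank ℝ W - k i) =>
      mapBody (T p.1) (Function.update A i (fun _ => B) p.1 p.2)) =
      fun p => if p.1 = i then mapBody (T i) B else mapBody (T p.1) (A p.1 p.2) := by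
    intro B
    funext ⟨i', j⟩
    by_cases hi : i' = i
    · subst hi
      simp
    · simp [hi]
  have hφ' : φ = fun B => c * mixedVolume volume
      fun p : (i : Fin l) × Fin (finrank ℝ W - k i) =>
        if p.1 = i then mapBody (T i) B else mapBody (T p.1) (A p.1 p.2) := by
    funext B
    rw [hφ, h, ← hupd]
  obtain ⟨h1, h2, h3⟩ := mixedVolume_mapBody_regularity
    (volume : Measure ((i : Fin l) × Fin (finrank ℝ W - k i) → ℝ)) (T i)
    (fun p : (i : Fin l) × Fin (finrank ℝ W - k i) => p.1 = i)
    fun p => mapBody (T p.1) (A p.1 p.2)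
  subst hφ'
  refine ⟨h1.const_mul c, fun t B ht => ?_, fun x B => ?_, continuous_const.mul h3⟩
  -- Only the entries of the `i`-th tuple are scaled by `t`, all others by one, so the product of
  -- the factors is the required power of `t`.
  · have hs : (fun p : (i : Fin l) × Fin (finrank ℝ W - k i) =>
        if p.1 = i then mapBody (T i) (t • B) else mapBody (T p.1) (A p.1 p.2)) =
        fun p => (if p.1 = i then t else 1) •
          if p.1 = i then mapBody (T i) B else mapBody (T p.1) (A p.1 p.2) := by
      funext p
      split_ifs
      · rw [mapBody_smul]
      · rw [one_smul]
    have hprod : ∏ p : (i : Fin l) × Fin (finrank ℝ W - k i), (if p.1 = i then t else 1) =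
        t ^ (finrank ℝ W - k i) := by
      rw [Fintype.prod_sigma]
      rw [Finset.prod_eq_single i]
      · simp
      · intro j _ hj
        simp [hj]
      · simp
    dsimp only
    rw [hs, mixedVolume_smul _ (fun p => by split_ifs <;> [exact ht; exact zero_le_one]), hprod]
    ring
  · exact congrArg (c * ·) (h2 x B)

end Coordinates

end HigherMixed

theorem proposition4p1 {W : Type*} [NormedAddCommGroup W] [NormedSpace ℝ W]
    [FiniteDimensional ℝ W] [MeasurableSpace W] [BorelSpace W]
    (μ : Measure W) [μ.IsAddHaarMeasure]
    {l : ℕ} [l.AtLeastTwo] (k : Fin l → ℕ) (hk : ∀ i, 0 < k i)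
    (hn : ∑ i, k i = finrank ℝ W) :
    -- (a) symmetry
    (∀ (ρ : Equiv.Perm (Fin l)) (A : ∀ i, Fin (finrank ℝ W - k i) → ConvexBody W),
      higherMixedVolume μ (fun i => k (ρ i)) (fun i => A (ρ i)) = higherMixedVolume μ k A) ∧
    -- (b) invariance under the special linear group
    (∀ (g : SpecialLinearGroup ℝ W) (A : ∀ i, Fin (finrank ℝ W - k i) → ConvexBody W),
      higherMixedVolume μ k (fun i j => mapBody (g : W ≃ₗ[ℝ] W).toLinearMap (A i j)) =
        higherMixedVolume μ k A) ∧
    -- (c) all bodies of the `i`-th tuple equal to `B`, the other tuples fixed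
    (∀ (A : ∀ i, Fin (finrank ℝ W - k i) → ConvexBody W) (i : Fin l) (φ : ConvexBody W → ℝ),
      (∀ B, φ B = higherMixedVolume μ k (Function.update A i fun _ => B)) →
      IsValuation φ ∧ IsHomogeneous (finrank ℝ W - k i) φ ∧ IsTranslationInvariant φ ∧
        Continuous φ) ∧
    -- (d) non-negativity and monotonicity
    (∀ A : ∀ i, Fin (finrank ℝ W - k i) → ConvexBody W, 0 ≤ higherMixedVolume μ k A) ∧
    (∀ A A' : ∀ i, Fin (finrank ℝ W - k i) → ConvexBody W,
      (∀ i j, (A i j : Set W) ⊆ A' i j) → higherMixedVolume μ k A ≤ higherMixedVolume μ k A') ∧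
    -- (e) positivity; `H i` is spanned by the directions of the segments `[x i j, y i j]`
    (∀ A : ∀ i, Fin (finrank ℝ W - k i) → ConvexBody W,
      0 < higherMixedVolume μ k A ↔
        ∃ x y : ∀ i, Fin (finrank ℝ W - k i) → W,
          (∀ i j, segment ℝ (x i j) (y i j) ⊆ (A i j : Set W)) ∧
          (∀ i, finrank ℝ (Submodule.span ℝ (Set.range fun j => y i j - x i j)) =
            finrank ℝ W - k i) ∧
          ⨅ i, Submodule.span ℝ (Set.range fun j => y i j - x i j) = ⊥) := by
  exact ⟨fun ρ A => higherMixedVolume_perm μ k ρ A,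
    fun g A => higherMixedVolume_specialLinear μ k g A,
    fun A i _ hφ => higherMixedVolume_update_regularity μ hn A i hφ,
    fun A => higherMixedVolume_nonneg μ hn A,
    fun _ _ hA => higherMixedVolume_mono μ hn hA,
    fun A => higherMixedVolume_pos_iff μ hn A⟩
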